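/- **Setup.** Let $n\ge 2$ and let $\lambda=(\lambda_1\ge\lambda_2\ge\cdots)$ be a partition with at most $n-1$ parts, with conjugate $\lambda'$, viewed as the weight $\sum_i\lambda_i\varepsilon_i$ in $\mathbb{R}^n/\mathbb{R}(1,\dots,1)$. Let $\alpha_{ij}=\varepsilon_i-\varepsilon_j$ be the roots of type $A_{n-1}$ (positive iff $i<j$), $\langle v,\alpha_{ij}^\vee\rangle=v_i-v_j$, $s_\alpha$ the corresponding transposition in $S_n$, $s_{\alpha,k}$ the reflection in the affine hyperplane $H_{\alpha,k}=\{v:\langle v,\alpha^\vee\rangle=k\}$, $\rho=(n-1,\dots,1,0)$, $\ell$ the number of inversions, $\operatorname{sgn}(\alpha)=\pm1$ and $|\alpha|=\operatorname{sgn}(\alpha)\alpha$. Put $\alpha_p=\alpha_{p,p+1}$ for $1\le p\le n-1$ and $\alpha_0=\alpha_{n1}$. The quantum Bruhat graph on $S_n$ has an edge $w\xrightarrow{\beta}ws_\beta$, for $\beta$ a positive root, if $\ell(ws_\beta)=\ell(w)+1$ or $\ell(ws_\beta)=\ell(w)-2\langle\rho,\beta^\vee\rangle+1$. **Admissible subsets.**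 Let $\Gamma(k)$ be the list of the roots $\alpha_{ab}$, $a\le k<b$, with $a$ running from $k$ down to $1$ and, for each $a$, $b$ running from $k+1$ up to $n$. Let $\Gamma=(\beta_1,\dots,\beta_m)=\Gamma^1\cdots\Gamma^{\lambda_1}$ with $\Gamma^j=\Gamma(\lambda'_j)$. Put $r_i=s_{\beta_i}$, $l_i=|\{j<i:\beta_j=\beta_i\}|$ and $\widehat r_i=s_{\beta_i,-l_i}$. A subset $J=\{j_1<\dots<j_s\}\subseteq[m]$ is *admissible*, $J\in\mathcal{A}(\lambda)$, if $1\xrightarrow{\beta_{j_1}}r_{j_1}\xrightarrow{\beta_{j_2}}\cdots\xrightarrow{\beta_{j_s}}r_{j_1}\cdots r_{j_s}$ is a path in the quantum Bruhat graph. For $i\in[m]$ let $j_1<\dots<j_q$ be the elements of $J$ less than $i$; put $\gamma_i=r_{j_1}\cdots r_{j_q}(\beta_i)$ and define $l_i^\Delta$ by $H_{|\gamma_i|,-l_i^\Delta}=\widehat r_{j_1}\cdots\widehat r_{j_q}(H_{\beta_i,-l_i})$. Put $\gamma_\infty=r_{j_1}\cdots r_{j_s}(\rho)$ and $\mu(J)=-\widehat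 r_{j_1}\cdots\widehat r_{j_s}(-\lambda)$. For a root $\alpha$ let $I_\alpha=\{i\in[m]:\gamma_i=\pm\alpha\}=\{i_1<\dots<i_t\}$, $\widehat I_\alpha=I_\alpha\cup\{\infty\}$ with $\infty$ larger than every element of $[m]$, and write $l^\Delta_\infty=\langle\mu(J),\operatorname{sgn}(\alpha)\alpha^\vee\rangle$. For $\alpha>0$ let $g_\alpha:[0,t+\frac12]\to\mathbb{R}$ be the continuous piecewise-linear function with $g_\alpha(0)=-\frac12$ and slope $\operatorname{sgn}(\gamma_{i_k})$ on $(k-1,k-\frac12)$, slope $\operatorname{sgn}(\gamma_{i_k})$ if $i_k\notin J$ and $-\operatorname{sgn}(\gamma_{i_k})$ if $i_k\in J$ on $(k-\frac12,k)$, for $1\le k\le t$, and slope $\operatorname{sgn}\langle\gamma_\infty,\alpha^\vee\rangle$ on $(t,t+\frac12)$; for $\alpha<0$ let $g_\alpha=-g_{-\alpha}$. *Operators $f_p$ on $\mathcal{A}(\lambda)$*, $0\le p\le n-1$. Let $M=\max g_{\alpha_p}$. If $M\le\delta_{p,0}$, then $f_p(J)=\mathbf 0$. If $M>\delta_{p,0}$,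 let $m^*$ be the least $i\in\widehat I_{\alpha_p}$ with $\operatorname{sgn}(\alpha_p)\,l_i^\Delta=M$ and let $k$ be its predecessor in $\widehat I_{\alpha_p}$ (both exist for admissible $J$); then $f_p(J)=(J\setminus\{m^*\})\cup\{k\}$, where $J\setminus\{\infty\}=J$. **Tensor products of columns.** $B^{\otimes\lambda}=B^{\lambda_1',1}\otimes B^{\lambda_2',1}\otimes\cdots\otimes B^{\lambda'_{\lambda_1},1}$ is the set of fillings of the Young diagram $\lambda$ with entries in $[n]$ whose columns strictly increase from top to bottom. For $b\in B^{\otimes\lambda}$ and $p\ne0$ (resp. $p=0$), write a sign $+$ for each letter $p$ (resp. $n$) and a sign $-$ for each letter $p+1$ (resp. $1$), going through the columns from left to right; a column that contains both letters contributes $-+$. Remove adjacent factors $-+$ until a word $+\cdots+-\cdots-$ remains. If it has no $+$, then $f_p(b)=\mathbf 0$; otherwise $f_p(b)$ is obtained by changing the letter of the rightmost remaining $+$ from $p$ to $p+1$ (resp. from $n$ to $1$) and sorting its column ascendingly. Let $\varphi_p(b)=\max\{k:f_p^k(b)\ne\mathbf 0\}$. There is a *dual Demazure arrow* $b\to f_p(b)$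 if $f_p(b)\ne\mathbf 0$ and either $p\ne0$, or $p=0$ and $\varphi_0(b)\ge2$. **Sorted filling map.** For $J\subseteq[m]$ let $\pi_j$ be the product, in increasing order of positions, of the transpositions $r_i$ over the $i\in J$ that lie in $\Gamma^1,\dots,\Gamma^j$. Then $\mathrm{sfill}(J)\in B^{\otimes\lambda}$ is the filling whose $j$-th column consists of $\pi_j(1),\dots,\pi_j(\lambda'_j)$, sorted ascendingly. **Theorem.** Let $J\in\mathcal{A}(\lambda)$, $b=\mathrm{sfill}(J)$ and $p\in\{0,1,\dots,n-1\}$. There is a dual Demazure arrow $b\to f_p(b)$ if and only if $f_p(J)\ne\mathbf 0$, and in that case $f_p(b)=\mathrm{sfill}(f_p(J))$. -/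

import Mathlib

namespace QAlcove

/-! ### Type `A_{n-1}`: roots, weights, Weyl group

The letters and coordinates `1, …, n` are the elements of `Fin n`, the letter `c` being the
element with value `c - 1`.  A root `α_{ij} = ε_i - ε_j` is the pair `(i, j)`, `i ≠ j`; its coroot
is itself.  The Weyl group is `Equiv.Perm (Fin n)`.  A point of `ℝ^n / ℝ(1,…,1)` is given by any
representative in `Fin n → R`, where `R` is `ℝ`, or `ℤ` for weights; everything below depends
only on the differences of coordinates. -/

/-- The (co)root `ε_i - ε_j` as a vector. -/
def rootVec {n : ℕ} (R : Type*) [Ring R] (α : Fin n × Fin n) : Fin n → R :=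
  Pi.single α.1 1 - Pi.single α.2 1

/-- The pairing `⟨v, α^∨⟩ = v_i - v_j` for `α = α_{ij}`. -/
def pair {n : ℕ} {R : Type*} [Ring R] (v : Fin n → R) (α : Fin n × Fin n) : R :=
  v α.1 - v α.2

/-- `sgn(α)`: the root `α_{ij}` is positive iff `i < j`. -/
def sgn {n : ℕ} (α : Fin n × Fin n) : ℤ := if α.1 < α.2 then 1 else -1

/-- `|α| = sgn(α) α`. -/
def absRoot {n : ℕ} (α : Fin n × Fin n) : Fin n × Fin n := if α.1 < α.2 then α else α.swap

/-- The reflection `s_α`, a transposition. -/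
def refl {n : ℕ} (α : Fin n × Fin n) : Equiv.Perm (Fin n) := Equiv.swap α.1 α.2

/-- The action `w(α_{ij}) = α_{w(i) w(j)}`. -/
def act {n : ℕ} (w : Equiv.Perm (Fin n)) (α : Fin n × Fin n) : Fin n × Fin n := (w α.1, w α.2)

/-- `ρ = (n-1, n-2, …, 0)`. -/
def rho (n : ℕ) : Fin n → ℤ := fun x => (n : ℤ) - 1 - (x : ℤ)

/-- The action of `w` on vectors, `w(ε_i) = ε_{w(i)}`. -/
def actVec {n : ℕ} (w : Equiv.Perm (Fin n)) (v : Fin n → ℤ) : Fin n → ℤ := fun x => v (w⁻¹ x)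

/-- The length of a permutation: its number of inversions, i.e. the number of positive roots that
it makes negative. -/
def len {n : ℕ} (w : Equiv.Perm (Fin n)) : ℕ :=
  (Finset.univ.filter fun α : Fin n × Fin n => α.1 < α.2 ∧ w α.2 < w α.1).card

/-- The edges `w → w s_β` (`β` a positive root) of the quantum Bruhat graph: either
`ℓ(w s_β) = ℓ(w) + 1`, or `ℓ(w s_β) = ℓ(w) - 2⟨ρ, β^∨⟩ + 1`. -/
def QBEdge {n : ℕ} (w : Equiv.Perm (Fin n)) (β : Fin n × Fin n) : Prop :=
  (len (w * refl β) : ℤ) = len w + 1 ∨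
  (len (w * refl β) : ℤ) = len w - 2 * pair (rho n) β + 1

/-- `α_p`: for `p = 1, …, n-1` the simple root `α_{p,p+1}`, and for `p = 0` the root
`θ = α_{n1}`.  With letters in `Fin n` it is the pair `(p - 1, p)`, where `0 - 1` is the last
element of `Fin n`. -/
def crystalRoot {n : ℕ} [NeZero n] (p : Fin n) : Fin n × Fin n := (p - 1, p)

/-- The reflection `s_{α,k}` in the affine hyperplane `⟨v, α^∨⟩ = k`. -/
def affRefl {n : ℕ} {R : Type*} [Ring R] (α : Fin n × Fin n) (k : ℤ) (v : Fin n → R) :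
    Fin n → R :=
  v - (pair v α - (k : R)) • rootVec R α

/-- The affine hyperplane `H_{α,k}`. -/
def hyperplane {n : ℕ} (α : Fin n × Fin n) (k : ℤ) : Set (Fin n → ℝ) := {v | pair v α = (k : ℝ)}

/-! ### Partitions, `λ`-chains, admissible subsets -/

/-- Partitions with at most `n - 1` parts: Young diagrams whose first column has height less
than `n`. Rows and columns are numbered from `0`, so `rowLen i` is `λ_{i+1}` and `colLen j` is
`λ'_{j+1}`. -/
abbrev Shape (n : ℕ) := {lam : YoungDiagram // lam.colLen 0 < n}

/-- The dominant weight `λ = ∑ λ_i ε_i`. -/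
def weight {n : ℕ} (lam : Shape n) : Fin n → ℤ := fun x => (lam.1.rowLen x : ℤ)

/-- The `ω_k`-chain `Γ(k)`: the roots `(a, b)` with `a ≤ k < b`, listed with `a` running down from
`k` to `1` and, for every `a`, with `b` running up from `k + 1` to `n`. -/
def omegaChain (n k : ℕ) : List (Fin n × Fin n) :=
  ((List.finRange n).filter (fun a => a.1 < k)).reverse.flatMap fun a =>
    ((List.finRange n).filter (fun b => k ≤ b.1)).map fun b => (a, b)

/-- The `λ`-chain `Γ = Γ(λ'_1) Γ(λ'_2) ⋯ Γ(λ'_{λ_1})`, each root accompanied by the index of the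
block that it belongs to. -/
def chain {n : ℕ} (lam : Shape n) : List (Fin (lam.1.rowLen 0) × (Fin n × Fin n)) :=
  (List.finRange (lam.1.rowLen 0)).flatMap fun (j : Fin (lam.1.rowLen 0)) =>
    (omegaChain n (lam.1.colLen j)).map fun β => (j, β)

/-- The set `[m]` of positions in the `λ`-chain. -/
abbrev Pos {n : ℕ} (lam : Shape n) := Fin (chain lam).length

/-- The root `β_i`. -/
def beta {n : ℕ} {lam : Shape n} (i : Pos lam) : Fin n × Fin n := ((chain lam).get i).2

/-- The index `j` of the block `Γ^j` that contains position `i`. -/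
def block {n : ℕ} {lam : Shape n} (i : Pos lam) : Fin (lam.1.rowLen 0) := ((chain lam).get i).1

/-- `l_i = |{j < i ; β_j = β_i}|`. -/
def lvl {n : ℕ} {lam : Shape n} (i : Pos lam) : ℕ :=
  (Finset.univ.filter fun j : Pos lam => j < i ∧ beta j = beta i).card

/-- `r_{j_1} r_{j_2} ⋯ r_{j_s}` for `J = {j_1 < ⋯ < j_s}`. -/
def foldPerm {n : ℕ} {lam : Shape n} (J : Finset (Pos lam)) : Equiv.Perm (Fin n) :=
  (J.sort.map fun j => refl (beta j)).prod

/-- `r̂_{j_1} r̂_{j_2} ⋯ r̂_{j_s}` for `J = {j_1 < ⋯ < j_s}`, where `r̂_i = s_{β_i, -l_i}`. -/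
def foldAff {n : ℕ} {lam : Shape n} {R : Type*} [Ring R] (J : Finset (Pos lam))
    (v : Fin n → R) : Fin n → R :=
  J.sort.foldr (fun j u => affRefl (beta j) (-(lvl j : ℤ)) u) v

/-- The folding positions less than `i`. -/
def before {n : ℕ} {lam : Shape n} (J : Finset (Pos lam)) (i : Pos lam) : Finset (Pos lam) :=
  J.filter (· < i)

/-- `J` is admissible: `1 → r_{j_1} → r_{j_1} r_{j_2} → ⋯ → r_{j_1} ⋯ r_{j_s}`, with labels
`β_{j_1}, …, β_{j_s}`, is a path in the quantum Bruhat graph. -/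
def Admissible {n : ℕ} {lam : Shape n} (J : Finset (Pos lam)) : Prop :=
  ∀ j ∈ J, QBEdge (foldPerm (before J j)) (beta j)

/-- The root `γ_i` of the folded chain `Γ(J)`. -/
def gam {n : ℕ} {lam : Shape n} (J : Finset (Pos lam)) (i : Pos lam) : Fin n × Fin n :=
  act (foldPerm (before J i)) (beta i)

/-- `γ_∞ = r_{j_1} ⋯ r_{j_s}(ρ)`. -/
def gamInf {n : ℕ} {lam : Shape n} (J : Finset (Pos lam)) : Fin n → ℤ :=
  actVec (foldPerm J) (rho n)

/-- The weight `μ(J) = - r̂_{j_1} ⋯ r̂_{j_s}(-λ)`. -/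
def mu {n : ℕ} {lam : Shape n} (J : Finset (Pos lam)) : Fin n → ℤ :=
  -foldAff J (-weight lam)

/-- The height `l_i^Δ` of the `i`-th root of the folded chain, which is determined by
`H_{|γ_i|, -l_i^Δ} = r̂_{j_1} ⋯ r̂_{j_p}(H_{β_i, -l_i})` (see `image_hyperplane` below). It is read
off from the image of the point `-l_i ε_a` of the hyperplane `H_{β_i, -l_i}`, for `β_i = (a,b)`. -/
def foldLvl {n : ℕ} {lam : Shape n} (J : Finset (Pos lam)) (i : Pos lam) : ℤ :=
  -pair (foldAff (before J i) (Pi.single (beta i).1 (-(lvl i : ℤ)))) (absRoot (gam J i))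

theorem beta_lt {n : ℕ} {lam : Shape n} (i : Pos lam) : (beta i).1 < (beta i).2 := by
  have h : (chain lam).get i ∈ chain lam := List.get_mem _ _
  simp only [chain, omegaChain, List.mem_flatMap, List.mem_map, List.mem_reverse,
    List.mem_filter, decide_eq_true_eq] at h
  obtain ⟨j, -, β, ⟨a, ⟨-, ha⟩, b, ⟨-, hb⟩, rfl⟩, h⟩ := h
  have h' : beta i = (a, b) := congrArg Prod.snd h.symm
  rw [h']
  exact Fin.lt_def.2 (ha.trans_le hb)

theorem affRefl_apply {n : ℕ} {R : Type*} [Ring R] (α : Fin n × Fin n) (k : ℤ) (v : Fin n → R)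
    (x : Fin n) :
    affRefl α k v x = v ((refl α)⁻¹ x) + ((k * rootVec ℤ α x : ℤ) : R) := by
  obtain ⟨a, b⟩ := α
  by_cases hab : a = b
  · subst hab
    simp [affRefl, refl, rootVec, pair]
  · by_cases hxa : x = a
    · subst hxa
      simp [affRefl, refl, rootVec, pair, hab]
      abel
    · by_cases hxb : x = b
      · subst hxb
        have hba : ¬ x = a := hxa
        simp [affRefl, refl, rootVec, pair, hba]
        abel
      · simp [affRefl, refl, rootVec, pair, hxa, hxb, Equiv.swap_apply_of_ne_of_ne]

theorem foldAff_apply {n : ℕ} {lam : Shape n} (J : Finset (Pos lam)) :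
    ∃ τ : Fin n → ℤ,
      (∀ (v : Fin n → ℤ) x, foldAff J v x = v ((foldPerm J)⁻¹ x) + τ x) ∧
      (∀ (v : Fin n → ℝ) x, foldAff J v x = v ((foldPerm J)⁻¹ x) + (τ x : ℝ)) := by
  unfold foldAff foldPerm
  induction J.sort with
  | nil => exact ⟨0, by simp, by simp⟩
  | cons j l ih =>
    obtain ⟨τ, h1, h2⟩ := ih
    refine ⟨fun x => τ ((refl (beta j))⁻¹ x) + (-(lvl j : ℤ)) * rootVec ℤ (beta j) x, ?_, ?_⟩
    · intro v x
      simp only [List.foldr_cons, List.map_cons, List.prod_cons, mul_inv_rev,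
        Equiv.Perm.mul_apply, affRefl_apply, h1]
      simp [add_assoc]
    · intro v x
      simp only [List.foldr_cons, List.map_cons, List.prod_cons, mul_inv_rev,
        Equiv.Perm.mul_apply, affRefl_apply, h2]
      push_cast
      ring

/-- `r̂_{j_1} ⋯ r̂_{j_p}(H_{β_i, -l_i}) = H_{|γ_i|, -l_i^Δ}`. -/
theorem image_hyperplane {n : ℕ} {lam : Shape n} (J : Finset (Pos lam)) (i : Pos lam) :
    foldAff (before J i) '' hyperplane (beta i) (-(lvl i : ℤ)) =
      hyperplane (absRoot (gam J i)) (-foldLvl J i) := by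
  obtain ⟨τ, h1, h2⟩ := foldAff_apply (before J i)
  have hne : (beta i).2 ≠ (beta i).1 := (beta_lt i).ne'
  have key : ∀ v : Fin n → ℝ, v ∈ hyperplane (beta i) (-(lvl i : ℤ)) ↔
      foldAff (before J i) v ∈ hyperplane (absRoot (gam J i)) (-foldLvl J i) := by
    intro v
    change pair v (beta i) = _ ↔ pair (foldAff (before J i) v) (absRoot (gam J i)) = _
    have hg : absRoot (gam J i) = gam J i ∨ absRoot (gam J i) = (gam J i).swap := by
      unfold absRoot
      split_ifs
      · exact Or.inl rfl
      · exact Or.inr rfl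
    unfold foldLvl
    rcases hg with hg | hg <;> rw [hg] <;> simp [gam, act, pair, h1, h2, hne] <;>
      constructor <;> intro h <;> linarith
  ext u
  constructor
  · rintro ⟨v, hv, rfl⟩
    exact (key v).1 hv
  · intro hu
    have hv : foldAff (before J i)
        (fun x => u (foldPerm (before J i) x) - (τ (foldPerm (before J i) x) : ℝ)) = u := by
      funext x
      simp [h2]
    exact ⟨_, (key _).2 (hv.symm ▸ hu), hv⟩

/-! ### The crystal operators on admissible subsets -/

/-- `I_α = {i ∈ [m] ; γ_i = ± α}`. -/
def iSet {n : ℕ} {lam : Shape n} (J : Finset (Pos lam)) (α : Fin n × Fin n) : Finset (Pos lam) :=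
  Finset.univ.filter fun i => gam J i = α ∨ gam J i = α.swap

/-- `Î_α = I_α ∪ {∞}`. -/
def iHat {n : ℕ} {lam : Shape n} (J : Finset (Pos lam)) (α : Fin n × Fin n) :
    Finset (WithTop (Pos lam)) :=
  insert ⊤ ((iSet J α).image WithTop.some)

/-- The height `l_i^Δ` for `i ∈ [m]`, and `l_α^∞ = ⟨μ(J), sgn(α) α^∨⟩` for `i = ∞`. -/
def hatLvl {n : ℕ} {lam : Shape n} (J : Finset (Pos lam)) (α : Fin n × Fin n) :
    WithTop (Pos lam) → ℤ
  | none => sgn α * pair (mu J) α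
  | some i => foldLvl J i

/-- For a positive root `α`, the slopes of `g_α` on the consecutive intervals of length `1/2`:
`sgn(γ_i), ε_i sgn(γ_i)` for the successive `i ∈ I_α`, and finally `sgn⟨γ_∞, α^∨⟩`. -/
def slopes {n : ℕ} {lam : Shape n} (J : Finset (Pos lam)) (α : Fin n × Fin n) : List ℤ :=
  ((iSet J α).sort.flatMap fun i =>
    [sgn (gam J i), (if i ∈ J then -1 else 1) * sgn (gam J i)]) ++
  [Int.sign (pair (gamInf J) α)]

/-- The value `g_α(t/2)` of the piecewise-linear function `g_α` at the `t`-th break point. For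
`α > 0` it starts at `g_α(0) = -1/2`; for `α < 0` it is `-g_{-α}`. -/
def graph {n : ℕ} {lam : Shape n} (J : Finset (Pos lam)) (α : Fin n × Fin n) (t : ℕ) : ℚ :=
  (sgn α : ℚ) * (-(1 / 2) + (1 / 2) * ((((slopes J (absRoot α)).take t).sum : ℤ) : ℚ))

/-- The maximum of `g_α`; being piecewise linear, `g_α` has it at a break point. -/
def graphMax {n : ℕ} {lam : Shape n} (J : Finset (Pos lam)) (α : Fin n × Fin n) : ℚ :=
  (Finset.range ((slopes J (absRoot α)).length + 1)).sup' ⟨0, by simp⟩ (graph J α)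

/-- The indices `i ∈ Î_α` with `sgn(α) l_i^Δ = M`, where `M` is the maximum of `g_α`. -/
def maxSet {n : ℕ} {lam : Shape n} (J : Finset (Pos lam)) (α : Fin n × Fin n) :
    Finset (WithTop (Pos lam)) :=
  (iHat J α).filter fun i => ((sgn α * hatLvl J α i : ℤ) : ℚ) = graphMax J α

/-- The crystal operator `f_p` on subsets of `[m]`; `none` is `𝟎`.  If `M > δ_{p,0}`, then `m` is
the least index of `Î_{α_p}` with `sgn(α_p) l_m^Δ = M`, `k` is the predecessor of `m` in
`Î_{α_p}`, and `f_p(J) = (J \ {m}) ∪ {k}`, where `J \ {∞} = J`. -/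
def alcoveF {n : ℕ} [NeZero n] {lam : Shape n} (p : Fin n) (J : Finset (Pos lam)) :
    Option (Finset (Pos lam)) :=
  if (if p = 0 then 1 else 0) < graphMax J (crystalRoot p) then
    if hm : (maxSet J (crystalRoot p)).Nonempty then
      let m := (maxSet J (crystalRoot p)).min' hm
      let below := (iSet J (crystalRoot p)).filter fun i => WithTop.some i < m
      if hk : below.Nonempty then
        some ((J.filter fun j => WithTop.some j ≠ m) ∪ {below.max' hk})
      else none
    else none
  else none

/-! ### Tensor products of column KR crystals -/

/-- Fillings of the Young diagram `λ` with entries in `[n]`, column by column; the entries of a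
column are listed from top to bottom. -/
abbrev Filling {n : ℕ} (lam : Shape n) :=
  (j : Fin (lam.1.rowLen 0)) → Fin (lam.1.colLen j) → Fin n

/-- The set underlying `B^{⊗λ} = B^{λ'_1,1} ⊗ B^{λ'_2,1} ⊗ ⋯`: the fillings of `λ` with strictly
increasing columns. -/
def KRTensor {n : ℕ} (lam : Shape n) : Set (Filling lam) := {b | ∀ j, StrictMono (b j)}

/-- Sorting a column ascendingly. -/
def sortCol {n r : ℕ} (c : Fin r → Fin n) : Fin r → Fin n := c ∘ Tuple.sort c

theorem sortCol_strictMono {n r : ℕ} {c : Fin r → Fin n} (hc : Function.Injective c) :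
    StrictMono (sortCol c) :=
  (Tuple.monotone_sort c).strictMono_of_injective (hc.comp (Tuple.sort c).injective)

/-- The contribution of column `j` to the `p`-signature. The letter `α_p.1` (`p`, or `n` if
`p = 0`) is a `+`, encoded as `true`; the letter `α_p.2` (`p + 1`, or `1` if `p = 0`) is a `-`,
encoded as `false`.  If a column contains both letters, then it contributes `-+`: for `p ≠ 0` this
is the order in the word of the column, which is read from bottom to top, and for `p = 0` it says
that a column containing both `1` and `n` is a trivial `0`-string, as it is in `B^{r,1}`. -/
def colWord {n : ℕ} [NeZero n] {lam : Shape n} (p : Fin n) (b : Filling lam)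
    (j : Fin (lam.1.rowLen 0)) : List (Bool × Fin (lam.1.rowLen 0)) :=
  (if ∃ x, b j x = (crystalRoot p).2 then [(false, j)] else []) ++
  (if ∃ x, b j x = (crystalRoot p).1 then [(true, j)] else [])

/-- Putting a sign in front of a reduced word `++⋯+--⋯-`: a `-` cancels with a `+` next to it. -/
def push {β : Type*} (s : Bool × β) : List (Bool × β) → List (Bool × β)
  | [] => [s]
  | t :: w => if s.1 = false ∧ t.1 = true then w else s :: t :: w

/-- The reduced `p`-signature `++⋯+--⋯-`, obtained by removing factors `-+` as long as there are
any; each sign carries the index of its column. -/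
def signature {n : ℕ} [NeZero n] {lam : Shape n} (p : Fin n) (b : Filling lam) :
    List (Bool × Fin (lam.1.rowLen 0)) :=
  ((List.finRange (lam.1.rowLen 0)).flatMap (colWord p b)).foldr push []

/-- The crystal operator `f_p` on `B^{⊗λ}`; `none` is `𝟎`. In the column of the rightmost `+` of
the reduced `p`-signature, the letter `α_p.1` is replaced by `α_p.2`, and the column is sorted. -/
def crystalF {n : ℕ} [NeZero n] {lam : Shape n} (p : Fin n) (b : Filling lam) :
    Option (Filling lam) :=
  (((signature p b).filter fun s => s.1).getLast?).map fun s =>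
    Function.update b s.2
      (sortCol fun x => if b s.2 x = (crystalRoot p).1 then (crystalRoot p).2 else b s.2 x)

theorem mem_of_mem_push {β : Type*} {s t : Bool × β} {w : List (Bool × β)} (h : t ∈ push s w) :
    t = s ∨ t ∈ w := by
  cases w with
  | nil => simpa [push] using h
  | cons u w =>
    simp only [push] at h
    split_ifs at h
    · exact Or.inr (List.mem_cons_of_mem _ h)
    · simpa using h

/-- The crystal operators preserve `B^{⊗λ}`. -/
theorem crystalF_mem {n : ℕ} [NeZero n] {lam : Shape n} {p : Fin n} {b c : Filling lam}
    (hb : b ∈ KRTensor lam) (h : crystalF p b = some c) : c ∈ KRTensor lam := by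
  have key : ∀ (l : List (Fin (lam.1.rowLen 0))) (j : Fin (lam.1.rowLen 0)),
      (true, j) ∈ (l.flatMap (colWord p b)).foldr push [] →
      ¬ ∃ x, b j x = (crystalRoot p).2 := by
    intro l
    induction l with
    | nil => simp
    | cons i l ih =>
      intro j hj
      rw [List.flatMap_cons, List.foldr_append] at hj
      by_cases h1 : ∃ x, b i x = (crystalRoot p).1 <;>
        by_cases h2 : ∃ x, b i x = (crystalRoot p).2 <;>
        simp only [colWord, h1, h2, if_true, if_false, List.nil_append, List.append_nil,
          List.cons_append, List.foldr_cons, List.foldr_nil] at hj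
      · apply ih j
        revert hj
        cases (l.flatMap (colWord p b)).foldr push [] with
        | nil => simp [push]
        | cons t w => simp [push]
      · rcases mem_of_mem_push hj with hj | hj
        · cases hj; exact h2
        · exact ih j hj
      · rcases mem_of_mem_push hj with hj | hj
        · cases hj
        · exact ih j hj
      · exact ih j hj
  simp only [crystalF, Option.map_eq_some_iff] at h
  obtain ⟨⟨s, j⟩, hs, rfl⟩ := h
  have hs' := List.mem_of_getLast? hs
  simp only [List.mem_filter] at hs'
  obtain ⟨hs1, rfl⟩ := hs'
  have hj := key _ j hs1
  intro i
  by_cases hij : i = j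
  · subst hij
    simp only [Function.update_self]
    apply sortCol_strictMono
    intro x y hxy
    simp only at hxy
    split_ifs at hxy with hx hy hy
    · exact (hb i).injective (hx.trans hy.symm)
    · exact absurd ⟨y, hxy.symm⟩ hj
    · exact absurd ⟨x, hxy⟩ hj
    · exact (hb i).injective hxy
  · simpa only [Function.update_of_ne hij] using hb i

/-- `φ_p(b) = max {k ; f_p^k(b) ≠ 𝟎}`. -/
noncomputable def phi {n : ℕ} [NeZero n] {lam : Shape n} (p : Fin n) (b : Filling lam) : ℕ :=
  sSup {k : ℕ | (fun x : Option (Filling lam) => x.bind (crystalF p))^[k] (some b) ≠ none}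

/-- There is a dual Demazure arrow `b → f_p(b)`. -/
def DualDemazure {n : ℕ} [NeZero n] {lam : Shape n} (p : Fin n) (b : Filling lam) : Prop :=
  crystalF p b ≠ none ∧ (p ≠ 0 ∨ 2 ≤ phi p b)

/-! ### The filling map -/

/-- `π_j = T^1 ⋯ T^j`, the product of the transpositions at the positions of `J` in the blocks
`Γ^1, …, Γ^j`. -/
def blockPerm {n : ℕ} {lam : Shape n} (J : Finset (Pos lam)) (j : Fin (lam.1.rowLen 0)) :
    Equiv.Perm (Fin n) :=
  foldPerm (J.filter fun i => block i ≤ j)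

/-- The filling map: the `j`-th column of `fill(J)` consists of the first `λ'_j` letters of
`π_j`. -/
def fill {n : ℕ} {lam : Shape n} (J : Finset (Pos lam)) : Filling lam := fun j x =>
  blockPerm J j
    (Fin.castLE ((lam.1.colLen_anti 0 j (Nat.zero_le _)).trans lam.2.le) x)

/-- The sorted filling map. -/
def sfill {n : ℕ} {lam : Shape n} (J : Finset (Pos lam)) : Filling lam := fun j =>
  sortCol (fill J j)

theorem sfill_mem {n : ℕ} {lam : Shape n} (J : Finset (Pos lam)) : sfill J ∈ KRTensor lam :=
  fun j => sortCol_strictMono ((blockPerm J j).injective.comp (Fin.castLE_injective _))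

end QAlcove

/-! Read the `λ`-chain as time and put `α = α_p`. Let `permAt J t` be the product of the folds
before time `t`, let `orient` be `1` or `-1` according to whether `α.1` stands before or after `α.2`
in that permutation, and let `height` be twice the value of `g_α` reached at time `t`. A visit is an
index `i ∈ I_α`. Doubling keeps all values integral.

The bridge between the two models is `height + orient = 2 * content`, where `content` counts letters
`α.1` minus letters `α.2` in the columns completed so far. It holds at the end of every block
(`height_blockTime`) and at every visit (`height_of_mem`). It follows from a quantity conserved
inside a block (`height_add_frontSign_succ`). The heights `l_i^Δ` and `μ(J)` are also letter counts
of completed columns (`foldLvl_eq`, `mu_eq`), so `sgn(α) l_i^Δ` is the value of `g_α` in the middle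
of visit `i`.

On the tensor side, the number of remaining signs `+` is the maximum of `content`, and `f_p` changes
the column where this maximum is first reached. Each application lowers the maximum by one, so it
equals `φ_p` (`phi_eq_plusCount`).

Admissibility enters through one property of quantum Bruhat edges: no position strictly between the
two exchanged ones carries a value cyclically between the exchanged values. As `α.2` is the cyclic
successor of `α.1`, these letters can pass from order `α.1`, `α.2` to the opposite order only by a
fold at `±α` (`Admissible.mem_of_orient`). Hence above the threshold `δ_{p,0}` the maximum of `g_α`
occurs only at midpoints of visits or at the end, and is the maximum of `content`. The only
exception, the starting value `1/2` of `g_{α_0}`, accounts for the threshold `1` at `p = 0` on both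
sides.

Let `m` be the first maximum and `k` the visit before it. Then `k` is unfolded, `m` is folded or
`∞`, and the block of `k` ends before `m` (`Admissible.block_lt`). Folding at `k` and unfolding at
`m` multiplies the permutations strictly after `k` and up to `m` by `s_α` on the left and leaves the
others alone. In the column of `k` this turns `α.1` into `α.2`; further columns completed in this
interval contain both letters or neither, so they do not change. -/

namespace QAlcove

/-! ### The order of the `λ`-chain -/

section Chain

variable {n : ℕ} {lam : Shape n}

/-- Strictness of this lexicographic order makes a position determined by its block and root
(`pos_ext`), and turns "already passed within the block" into inequalities between coordinates. -/
theorem chain_pairwise (lam : Shape n) :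
    (chain lam).Pairwise fun s t => s.1 < t.1 ∨ s.1 = t.1 ∧
      (t.2.1 < s.2.1 ∨ s.2.1 = t.2.1 ∧ s.2.2 < t.2.2) := by
  unfold chain omegaChain
  rw [List.pairwise_flatMap]
  refine ⟨fun j _ => ?_, ?_⟩
  · rw [List.pairwise_map, List.pairwise_flatMap]
    refine ⟨fun a _ => ?_, ?_⟩
    · rw [List.pairwise_map]
      exact ((List.pairwise_lt_finRange n).filter _).imp fun h => Or.inr ⟨rfl, Or.inr ⟨rfl, h⟩⟩
    · rw [List.pairwise_reverse]
      refine ((List.pairwise_lt_finRange n).filter _).imp fun {a b} h => ?_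
      intro x hx y hy
      simp only [List.mem_map] at hx hy
      obtain ⟨_, _, rfl⟩ := hx
      obtain ⟨_, _, rfl⟩ := hy
      exact Or.inr ⟨rfl, Or.inl h⟩
  · refine (List.pairwise_lt_finRange _).imp fun {i j} h => ?_
    intro x hx y hy
    simp only [List.mem_map] at hx hy
    obtain ⟨_, _, rfl⟩ := hx
    obtain ⟨_, _, rfl⟩ := hy
    exact Or.inl h

theorem chain_lex {i i' : Pos lam} (h : i < i') :
    block i < block i' ∨ block i = block i' ∧
      ((beta i').1 < (beta i).1 ∨ (beta i).1 = (beta i').1 ∧ (beta i).2 < (beta i').2) :=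
  List.pairwise_iff_get.1 (chain_pairwise lam) i i' h

theorem block_mono {i i' : Pos lam} (h : i ≤ i') : block i ≤ block i' := by
  rcases h.eq_or_lt with rfl | h
  · exact le_rfl
  · rcases chain_lex h with h | h
    · exact h.le
    · exact h.1.le

theorem pos_ext {i i' : Pos lam} (hb : block i = block i') (h : beta i = beta i') : i = i' := by
  rcases lt_trichotomy i i' with hi | hi | hi
  · rcases chain_lex hi with h1 | ⟨-, h1 | h1⟩
    · exact absurd hb h1.ne
    · exact absurd (congrArg Prod.fst h) h1.ne'
    · exact absurd (congrArg Prod.snd h) h1.2.ne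
  · exact hi
  · rcases chain_lex hi with h1 | ⟨-, h1 | h1⟩
    · exact absurd hb h1.ne'
    · exact absurd (congrArg Prod.fst h) h1.ne
    · exact absurd (congrArg Prod.snd h) h1.2.ne'

theorem exists_pos_iff {j : Fin (lam.1.rowLen 0)} {x y : Fin n} :
    (∃ i : Pos lam, block i = j ∧ beta i = (x, y)) ↔
      x.1 < lam.1.colLen j ∧ lam.1.colLen j ≤ y.1 := by
  have h1 : (∃ i : Pos lam, block i = j ∧ beta i = (x, y)) ↔ (j, (x, y)) ∈ chain lam := by
    rw [List.mem_iff_get]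
    constructor
    · rintro ⟨i, rfl, h⟩
      exact ⟨i, Prod.ext rfl h⟩
    · rintro ⟨i, h⟩
      exact ⟨i, congrArg Prod.fst h, congrArg Prod.snd h⟩
  rw [h1]
  simp only [chain, omegaChain, List.mem_flatMap, List.mem_map, List.mem_reverse,
    List.mem_filter, decide_eq_true_eq, List.mem_finRange, true_and]
  constructor
  · rintro ⟨j, β, ⟨a, ha, b, hb, rfl⟩, h⟩
    simp only [Prod.mk.injEq] at h
    obtain ⟨rfl, rfl, rfl⟩ := h
    exact ⟨ha, hb⟩
  · rintro ⟨hx, hy⟩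
    exact ⟨j, (x, y), ⟨x, hx, y, hy, rfl⟩, rfl⟩

theorem beta_fst_lt (i : Pos lam) : (beta i).1.1 < lam.1.colLen (block i) :=
  (exists_pos_iff.1 ⟨i, rfl, rfl⟩).1

theorem le_beta_snd (i : Pos lam) : lam.1.colLen (block i) ≤ (beta i).2.1 :=
  (exists_pos_iff.1 ⟨i, rfl, rfl⟩).2

/-- Within a block, the positions before `i`. -/
theorem exists_pos_lt_iff {i : Pos lam} {x y : Fin n} :
    (∃ i' : Pos lam, i' < i ∧ block i' = block i ∧ beta i' = (x, y)) ↔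
      (x.1 < lam.1.colLen (block i) ∧ lam.1.colLen (block i) ≤ y.1) ∧
        ((beta i).1 < x ∨ (beta i).1 = x ∧ y < (beta i).2) := by
  constructor
  · rintro ⟨i', hi, hb, h⟩
    refine ⟨exists_pos_iff.1 ⟨i', hb, h⟩, ?_⟩
    rcases chain_lex hi with h1 | ⟨-, h1⟩
    · exact absurd hb h1.ne
    · simp only [h] at h1
      rcases h1 with h1 | h1
      · exact Or.inl h1
      · exact Or.inr ⟨h1.1.symm, h1.2⟩
  · rintro ⟨hxy, h⟩
    obtain ⟨i', hb, h'⟩ := exists_pos_iff.2 hxy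
    refine ⟨i', ?_, hb, h'⟩
    by_contra hlt
    rcases (not_lt.1 hlt).eq_or_lt with rfl | hlt
    · rw [h'] at h
      rcases h with h | h
      · exact lt_irrefl _ h
      · exact lt_irrefl _ h.2
    · rcases chain_lex hlt with h1 | ⟨-, h1⟩
      · exact absurd hb h1.ne'
      · simp only [h'] at h1
        rcases h with h | h <;> rcases h1 with h1 | h1
        · exact lt_asymm h h1
        · exact h.ne h1.1
        · exact h1.ne' h.1
        · exact lt_asymm h.2 h1.2

/-- The number of positions in the first `j` blocks. -/
def blockTime (lam : Shape n) (j : ℕ) : ℕ :=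
  (Finset.univ.filter fun i : Pos lam => (block i).1 < j).card

theorem lt_blockTime {i : Pos lam} {j : ℕ} : i.1 < blockTime lam j ↔ (block i).1 < j := by
  unfold blockTime
  constructor
  · intro h
    by_contra hj
    have hsub : (Finset.univ.filter fun i : Pos lam => (block i).1 < j) ⊆ Finset.Iio i := by
      intro x hx
      simp only [Finset.mem_filter, Finset.mem_univ, true_and] at hx
      rw [Finset.mem_Iio]
      by_contra hlt
      have := block_mono (not_lt.1 hlt)
      rw [Fin.le_def] at this
      omega
    have := Finset.card_le_card hsub
    rw [Fin.card_Iio] at this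
    omega
  · intro h
    have hsub : Finset.Iic i ⊆ (Finset.univ.filter fun i : Pos lam => (block i).1 < j) := by
      intro x hx
      rw [Finset.mem_Iic] at hx
      have := block_mono hx
      rw [Fin.le_def] at this
      simp only [Finset.mem_filter, Finset.mem_univ, true_and]
      omega
    have := Finset.card_le_card hsub
    rw [Fin.card_Iic] at this
    omega

theorem blockTime_zero : blockTime lam 0 = 0 := by simp [blockTime]

theorem blockTime_le (j : ℕ) : blockTime lam j ≤ (chain lam).length :=
  (Finset.card_le_univ _).trans_eq (Fintype.card_fin _)

theorem blockTime_last {j : ℕ} (h : lam.1.rowLen 0 ≤ j) :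
    blockTime lam j = (chain lam).length := by
  unfold blockTime
  rw [Finset.filter_true_of_mem fun i _ => (block i).2.trans_le h, Finset.card_univ,
    Fintype.card_fin]

theorem blockTime_mono : Monotone (blockTime lam) := fun _ _ h =>
  Finset.card_le_card fun _ hi => by
    simp only [Finset.mem_filter, Finset.mem_univ, true_and] at hi ⊢
    exact hi.trans_le h

theorem block_eq {i : Pos lam} {j : ℕ} (h1 : blockTime lam j ≤ i.1)
    (h2 : i.1 < blockTime lam (j + 1)) : (block i).1 = j := by
  have h3 := lt_blockTime.1 h2
  have h4 : ¬ (block i).1 < j := fun h => by have := lt_blockTime.2 h; omega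
  omega

theorem blockTime_block_le (i : Pos lam) : blockTime lam (block i).1 ≤ i.1 :=
  not_lt.1 fun h => lt_irrefl _ (lt_blockTime.1 h)

theorem lt_blockTime_block (i : Pos lam) : i.1 < blockTime lam ((block i).1 + 1) :=
  lt_blockTime.2 (Nat.lt_succ_self _)

end Chain

/-! ### Initial segments of a set of positions -/

theorem _root_.Finset.sort_eq_append {α : Type*} [LinearOrder α] {s t : Finset α} {i : α}
    (hlt : ∀ x ∈ s, x < i) (ht : ∀ x, x ∈ t ↔ x ∈ s ∨ x = i) : t.sort = s.sort ++ [i] := by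
  refine List.Perm.eq_of_pairwise' (r := (· ≤ ·)) (Finset.pairwise_sort _ _) ?_ ?_
  · rw [List.pairwise_append]
    refine ⟨Finset.pairwise_sort _ _, List.pairwise_singleton _ _, fun x hx y hy => ?_⟩
    rw [Finset.mem_sort] at hx
    rw [List.mem_singleton] at hy
    exact hy ▸ (hlt x hx).le
  · rw [List.perm_ext_iff_of_nodup (Finset.sort_nodup _ _)]
    · intro x
      simp [ht]
    · rw [List.nodup_append]
      refine ⟨Finset.sort_nodup _ _, List.nodup_singleton _, fun x hx y hy => ?_⟩
      rw [Finset.mem_sort] at hx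
      rw [List.mem_singleton] at hy
      exact hy ▸ (hlt x hx).ne

section Cut

variable {n : ℕ} {lam : Shape n}

/-- The elements of `J` among the first `t` positions. -/
def cut (J : Finset (Pos lam)) (t : ℕ) : Finset (Pos lam) := J.filter fun i => i.1 < t

theorem before_eq_cut (J : Finset (Pos lam)) (i : Pos lam) : before J i = cut J i.1 := by
  ext x
  simp [before, cut]

theorem cut_zero (J : Finset (Pos lam)) : cut J 0 = ∅ := by simp [cut]

theorem cut_length (J : Finset (Pos lam)) : cut J (chain lam).length = J := by
  unfold cut
  exact Finset.filter_true_of_mem fun i _ => i.2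

theorem cut_succ_of_notMem {J : Finset (Pos lam)} {i : Pos lam} (h : i ∉ J) :
    cut J (i.1 + 1) = cut J i.1 := by
  ext x
  simp only [cut, Finset.mem_filter, and_congr_right_iff]
  intro hx
  have : x.1 ≠ i.1 := fun he => h (Fin.ext he ▸ hx)
  omega

theorem sort_cut_succ_of_mem {J : Finset (Pos lam)} {i : Pos lam} (h : i ∈ J) :
    (cut J (i.1 + 1)).sort = (cut J i.1).sort ++ [i] := by
  refine Finset.sort_eq_append (fun x hx => ?_) (fun x => ?_)
  · simp only [cut, Finset.mem_filter] at hx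
    exact hx.2
  · simp only [cut, Finset.mem_filter, Fin.ext_iff]
    constructor
    · rintro ⟨h1, h2⟩
      by_cases h3 : x.1 = i.1
      · exact Or.inr h3
      · exact Or.inl ⟨h1, by omega⟩
    · rintro (⟨h1, h2⟩ | h1)
      · exact ⟨h1, by omega⟩
      · exact ⟨Fin.ext h1 ▸ h, by omega⟩

/-- The permutation `r_{j_1} ⋯ r_{j_q}` of the elements of `J` among the first `t` positions. -/
def permAt (J : Finset (Pos lam)) (t : ℕ) : Equiv.Perm (Fin n) := foldPerm (cut J t)

theorem permAt_zero (J : Finset (Pos lam)) : permAt J 0 = 1 := by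
  simp [permAt, cut_zero, foldPerm]

theorem permAt_succ_of_notMem {J : Finset (Pos lam)} {i : Pos lam} (h : i ∉ J) :
    permAt J (i.1 + 1) = permAt J i.1 := by
  rw [permAt, cut_succ_of_notMem h, permAt]

theorem permAt_succ_of_mem {J : Finset (Pos lam)} {i : Pos lam} (h : i ∈ J) :
    permAt J (i.1 + 1) = permAt J i.1 * refl (beta i) := by
  simp [permAt, foldPerm, sort_cut_succ_of_mem h]

theorem permAt_length (J : Finset (Pos lam)) : permAt J (chain lam).length = foldPerm J := by
  rw [permAt, cut_length]

theorem foldPerm_before (J : Finset (Pos lam)) (i : Pos lam) :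
    foldPerm (before J i) = permAt J i.1 := by
  rw [permAt, before_eq_cut]

theorem blockPerm_eq (J : Finset (Pos lam)) (j : Fin (lam.1.rowLen 0)) :
    blockPerm J j = permAt J (blockTime lam (j.1 + 1)) := by
  unfold blockPerm permAt
  congr 1
  ext x
  simp only [cut, Finset.mem_filter, lt_blockTime, Fin.le_def, Nat.lt_succ_iff]

theorem gam_eq (J : Finset (Pos lam)) (i : Pos lam) :
    gam J i = act (permAt J i.1) (beta i) := by
  rw [gam, foldPerm_before]

/-- Induction along the `λ`-chain, from one time to another. -/
theorem time_induction {P : ℕ → Prop} {t₀ t₁ : ℕ} (ht : t₁ ≤ (chain lam).length) (h0 : P t₀)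
    (hs : ∀ i : Pos lam, t₀ ≤ i.1 → i.1 < t₁ → P i.1 → P (i.1 + 1)) {t : ℕ} (h1 : t₀ ≤ t)
    (h2 : t ≤ t₁) : P t := by
  induction t, h1 using Nat.le_induction with
  | base => exact h0
  | succ t h1 ih => exact hs ⟨t, Nat.lt_of_succ_le (h2.trans ht)⟩ h1 (Nat.lt_of_succ_le h2) (ih (by omega))

end Cut

/-! ### Edges of the quantum Bruhat graph -/

section Bruhat

variable {n : ℕ}

theorem len_eq_sum (w : Equiv.Perm (Fin n)) :
    (len w : ℤ) = ∑ x, ∑ y, if x < y ∧ w y < w x then 1 else 0 := by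
  rw [len, Finset.card_filter, Fintype.sum_prod_type]
  push_cast
  rfl

/-- Reindexing both positions by the transposition keeps the comparison of values and alters only
the comparison of positions, so the two inversion counts can be subtracted term by term. -/
theorem len_mul_refl (w : Equiv.Perm (Fin n)) {i j : Fin n} (hij : i < j) (hw : w i < w j) :
    (len (w * refl (i, j)) : ℤ) = len w + 1 +
      2 * ((Finset.Ioo i j).filter fun c => w i < w c ∧ w c < w j).card := by
  have hre : (len (w * refl (i, j)) : ℤ) =
      ∑ x, ∑ y, if refl (i, j) x < refl (i, j) y ∧ w y < w x then 1 else 0 := by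
    rw [len_eq_sum, ← Equiv.sum_comp (refl (i, j))]
    refine Finset.sum_congr rfl fun x _ => ?_
    rw [← Equiv.sum_comp (refl (i, j))]
    refine Finset.sum_congr rfl fun y _ => ?_
    have e : ∀ z, (w * refl (i, j)) (refl (i, j) z) = w z := fun z => by simp [refl]
    rw [e, e]
  -- Apart from the pair `(j, i)` itself, only pairs joining `i` or `j` to an intermediate position
  -- change status.
  have hpt : ∀ x y, (if refl (i, j) x < refl (i, j) y ∧ w y < w x then (1 : ℤ) else 0) =
      (if x < y ∧ w y < w x then 1 else 0) +
      ((if x = j then if y = i then 1 else 0 else 0) +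
      ((if y = i then if (i < x ∧ x < j) ∧ w i < w x then 1 else 0 else 0) +
      ((if x = j then if (i < y ∧ y < j) ∧ w y < w j then 1 else 0 else 0) -
      ((if x = i then if (i < y ∧ y < j) ∧ w y < w i then 1 else 0 else 0) +
      (if y = j then if (i < x ∧ x < j) ∧ w j < w x then 1 else 0 else 0))))) := by
    intro x y
    simp only [refl, Equiv.swap_apply_def]
    by_cases hxi : x = i
    · subst hxi
      by_cases hyi : y = x
      · subst hyi
        simp [hij.ne]
      · by_cases hyj : y = j
        · subst hyj
          simp [hij.ne, hij.ne', hw.not_gt, hij.not_gt]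
        · have := hij.ne
          simp only [hyi, hyj, hij.ne, if_true, if_false]
          split_ifs <;> first | rfl | (exfalso; omega)
    · by_cases hxj : x = j
      · subst hxj
        by_cases hyi : y = i
        · subst hyi
          simp [hij.ne, hij.ne', hw, hij, hij.not_gt]
        · by_cases hyj : y = x
          · subst hyj
            simp [hij.ne']
          · simp only [hyi, hyj, hxi, if_true, if_false]
            split_ifs <;> first | rfl | (exfalso; omega)
      · by_cases hyi : y = i
        · subst hyi
          simp only [hxi, hxj, hij.ne, if_true, if_false]
          split_ifs <;> first | rfl | (exfalso; omega)
        · by_cases hyj : y = j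
          · subst hyj
            simp only [hxi, hxj, hyi, if_true, if_false]
            split_ifs <;> first | rfl | (exfalso; omega)
          · simp [hxi, hxj, hyi, hyj]
  -- An intermediate value below `w i` or above `w j` contributes a gain and a loss that cancel; one
  -- strictly between contributes two gains.
  have hc : ∀ c, ((if (i < c ∧ c < j) ∧ w i < w c then (1 : ℤ) else 0) +
      (if (i < c ∧ c < j) ∧ w c < w j then 1 else 0) -
      (if (i < c ∧ c < j) ∧ w c < w i then 1 else 0) -
      (if (i < c ∧ c < j) ∧ w j < w c then 1 else 0)) =
      2 * if (i < c ∧ c < j) ∧ (w i < w c ∧ w c < w j) then 1 else 0 := by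
    intro c
    by_cases h : i < c ∧ c < j
    · have h1 : w c ≠ w i := fun h' => h.1.ne' (w.injective h')
      have h2 : w c ≠ w j := fun h' => h.2.ne (w.injective h')
      simp only [h, true_and, and_self]
      split_ifs <;> first | rfl | (exfalso; omega)
    · simp [h]
  have hcard : (((Finset.Ioo i j).filter fun c => w i < w c ∧ w c < w j).card : ℤ) =
      ∑ c, if (i < c ∧ c < j) ∧ (w i < w c ∧ w c < w j) then 1 else 0 := by
    rw [Finset.sum_boole]
    congr 2
    ext c
    simp
  rw [hre, hcard, Finset.mul_sum, ← Finset.sum_congr rfl fun c _ => hc c, len_eq_sum w]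
  simp only [hpt, Finset.sum_add_distrib, Finset.sum_sub_distrib]
  simp only [Finset.sum_ite_irrel, Finset.sum_const_zero, Finset.sum_ite_eq', Finset.mem_univ,
    if_true]
  ring

/-- Along an edge of the quantum Bruhat graph with label `(i, j)`, no value at a position between
`i` and `j` lies cyclically between the two values that are exchanged. -/
theorem QBEdge.not_between {w : Equiv.Perm (Fin n)} {i j : Fin n} (h : QBEdge w (i, j))
    (hij : i < j) {c : Fin n} (hic : i < c) (hcj : c < j) :
    (w i < w j → ¬ (w i < w c ∧ w c < w j)) ∧ (w j < w i → w j < w c ∧ w c < w i) := by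
  unfold QBEdge at h
  have hpair : pair (rho n) (i, j) = (j.1 : ℤ) - i.1 := by simp [pair, rho]
  rw [hpair] at h
  have hlt : (i.1 : ℤ) < j.1 := by exact_mod_cast hij
  constructor
  · intro hw hc
    rw [len_mul_refl w hij hw] at h
    have hpos : 0 < ((Finset.Ioo i j).filter fun c => w i < w c ∧ w c < w j).card :=
      Finset.card_pos.2 ⟨c, by simp [hic, hcj, hc]⟩
    omega
  · intro hw
    have h1 : (w * refl (i, j)) i = w j := by simp [refl]
    have h2 : (w * refl (i, j)) j = w i := by simp [refl]
    -- A descent of `w` is an ascent of `w * refl (i, j)`, to which the length formula applies.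
    have h3 := len_mul_refl (w * refl (i, j)) hij (by rwa [h1, h2])
    have h4 : w * refl (i, j) * refl (i, j) = w := by ext; simp [refl]
    rw [h4] at h3
    set S := (Finset.Ioo i j).filter fun c =>
      (w * refl (i, j)) i < (w * refl (i, j)) c ∧ (w * refl (i, j)) c < (w * refl (i, j)) j with hS
    have hcard : (Finset.Ioo i j).card = j.1 - i.1 - 1 := Fin.card_Ioo i j
    have hle : S.card ≤ (Finset.Ioo i j).card := Finset.card_filter_le _ _
    -- The length drops by `1 + 2 * S.card`, so the edge is a quantum one with drop `2(j - i) - 1`.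
    -- Thus `S` has `j - i - 1` elements, as many as the whole interval.
    have hSe : S = Finset.Ioo i j := Finset.eq_of_subset_of_card_le (Finset.filter_subset _ _) (by
      omega)
    have hc : c ∈ S := hSe ▸ Finset.mem_Ioo.2 ⟨hic, hcj⟩
    rw [hS, Finset.mem_filter, h1, h2] at hc
    have h5 : (w * refl (i, j)) c = w c := by
      simp [refl, Equiv.swap_apply_of_ne_of_ne hic.ne' hcj.ne]
    rw [h5] at hc
    exact hc.2

end Bruhat

/-! ### The letters of `α_p` -/

section Crystal

variable {n : ℕ} [NeZero n]

theorem crystalRoot_fst_val {p : Fin n} (hp : p ≠ 0) : (crystalRoot p).1.1 + 1 = p.1 := by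
  unfold crystalRoot
  have h1 : p.1 ≠ 0 := fun h => hp (Fin.ext h)
  have := p.2
  rw [Fin.val_sub_one_of_ne_zero hp]
  omega

theorem crystalRoot_zero_fst_val : (crystalRoot (0 : Fin n)).1.1 = n - 1 := by
  have hn := NeZero.pos n
  have h : (crystalRoot (0 : Fin n)).1.1 = (n - 1 % n) % n := by
    change ((0 : Fin n) - 1).1 = _
    rw [Fin.val_sub]
    simp
  rw [h]
  rcases Nat.lt_or_ge 1 n with h1 | h1
  · rw [Nat.mod_eq_of_lt h1, Nat.mod_eq_of_lt (by omega)]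
  · obtain rfl : n = 1 := by omega
    rfl

theorem crystalRoot_ne (hn : 2 ≤ n) (p : Fin n) : (crystalRoot p).1 ≠ (crystalRoot p).2 := by
  intro h
  have h' := congrArg Fin.val h
  by_cases hp : p = 0
  · subst hp
    rw [crystalRoot_zero_fst_val] at h'
    simp [crystalRoot] at h'
    omega
  · have := crystalRoot_fst_val hp
    simp only [crystalRoot] at this h'
    omega

theorem sgn_crystalRoot (p : Fin n) :
    sgn (crystalRoot p) = if p = 0 then -1 else 1 := by
  unfold sgn
  by_cases hp : p = 0
  · subst hp
    simp [crystalRoot]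
  · have := crystalRoot_fst_val hp
    rw [if_neg hp, if_pos]
    rw [Fin.lt_def]
    simp only [crystalRoot] at this ⊢
    omega

/-- The letter `α_p.2` is the cyclic successor of `α_p.1`. -/
theorem QBEdge.crystal_left {p : Fin n} {w : Equiv.Perm (Fin n)} {i j c : Fin n}
    (h : QBEdge w (i, j)) (hi : w i = (crystalRoot p).1) (hic : i < c) (hcj : c < j) :
    w c ≠ (crystalRoot p).2 := by
  intro hc
  obtain ⟨h1, h2⟩ := h.not_between (hic.trans hcj) hic hcj
  have hne : w c ≠ w j := fun h' => hcj.ne (w.injective h')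
  have hne' : w i ≠ w j := fun h' => (hic.trans hcj).ne (w.injective h')
  by_cases hp : p = 0
  · subst hp
    have e1 : (w i).1 = n - 1 := by rw [hi, crystalRoot_zero_fst_val]
    have e2 : (w c).1 = 0 := by rw [hc]; rfl
    have := (w j).2
    omega
  · have e1 : (w i).1 + 1 = p.1 := by rw [hi, crystalRoot_fst_val hp]
    have e2 : (w c).1 = p.1 := by rw [hc]; rfl
    omega

/-- Mirror image of `QBEdge.crystal_left`: `α_p.1` is the cyclic predecessor of `α_p.2`, so it would
lie cyclically between `w i` and `w j`. -/
theorem QBEdge.crystal_right {p : Fin n} {w : Equiv.Perm (Fin n)} {i j c : Fin n}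
    (h : QBEdge w (i, j)) (hj : w j = (crystalRoot p).2) (hic : i < c) (hcj : c < j) :
    w c ≠ (crystalRoot p).1 := by
  intro hc
  obtain ⟨h1, h2⟩ := h.not_between (hic.trans hcj) hic hcj
  have hne : w c ≠ w i := fun h' => hic.ne' (w.injective h')
  have hne' : w i ≠ w j := fun h' => (hic.trans hcj).ne (w.injective h')
  by_cases hp : p = 0
  · subst hp
    have e1 : (w c).1 = n - 1 := by rw [hc, crystalRoot_zero_fst_val]
    have e2 : (w j).1 = 0 := by rw [hj]; rfl
    have := (w i).2
    omega
  · have e1 : (w c).1 + 1 = p.1 := by rw [hc, crystalRoot_fst_val hp]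
    have e2 : (w j).1 = p.1 := by rw [hj]; rfl
    omega

end Crystal

/-! ### Crossings inside a block -/

section Front

variable {n : ℕ} {lam : Shape n}

/-- The root `(x, y)` occurs in block `j` among the first `t` positions. -/
def Crossed (lam : Shape n) (t : ℕ) (j : Fin (lam.1.rowLen 0)) (x y : Fin n) : Prop :=
  ∃ i : Pos lam, i.1 < t ∧ block i = j ∧ beta i = (x, y)

/-- `P` precedes `Q` in the order of `Fin n` that is obtained from the natural one by reversing
the pairs which block `j` has crossed before time `t`. -/
def Front (lam : Shape n) (t : ℕ) (j : Fin (lam.1.rowLen 0)) (P Q : Fin n) : Prop :=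
  (P < Q ∧ ¬ Crossed lam t j P Q) ∨ Crossed lam t j Q P

noncomputable instance (t : ℕ) (j : Fin (lam.1.rowLen 0)) (P Q : Fin n) :
    Decidable (Front lam t j P Q) := Classical.propDecidable _

theorem crossed_iff {i : Pos lam} {x y : Fin n} : Crossed lam i.1 (block i) x y ↔
    (x.1 < lam.1.colLen (block i) ∧ lam.1.colLen (block i) ≤ y.1) ∧
      ((beta i).1 < x ∨ (beta i).1 = x ∧ y < (beta i).2) :=
  exists_pos_lt_iff

theorem crossed_succ_iff {i : Pos lam} {x y : Fin n} : Crossed lam (i.1 + 1) (block i) x y ↔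
    (x.1 < lam.1.colLen (block i) ∧ lam.1.colLen (block i) ≤ y.1) ∧
      ((beta i).1 < x ∨ (beta i).1 = x ∧ y ≤ (beta i).2) := by
  have h : Crossed lam (i.1 + 1) (block i) x y ↔
      Crossed lam i.1 (block i) x y ∨ beta i = (x, y) := by
    constructor
    · rintro ⟨i', h1, h2, h3⟩
      rcases Nat.lt_succ_iff_lt_or_eq.1 h1 with h4 | h4
      · exact Or.inl ⟨i', h4, h2, h3⟩
      · exact Or.inr (Fin.ext h4 ▸ h3)
    · rintro (⟨i', h1, h2, h3⟩ | h3)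
      · exact ⟨i', by omega, h2, h3⟩
      · exact ⟨i, by omega, rfl, h3⟩
  have h1 := beta_fst_lt i
  have h2 := le_beta_snd i
  rw [h, crossed_iff, Prod.ext_iff]
  dsimp only
  omega

theorem not_crossed_blockTime {j : Fin (lam.1.rowLen 0)} {x y : Fin n} :
    ¬ Crossed lam (blockTime lam j.1) j x y := by
  rintro ⟨i, h1, rfl, -⟩
  exact lt_irrefl _ (lt_blockTime.1 h1)

theorem crossed_blockTime_succ {j : Fin (lam.1.rowLen 0)} {x y : Fin n} :
    Crossed lam (blockTime lam (j.1 + 1)) j x y ↔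
      x.1 < lam.1.colLen j ∧ lam.1.colLen j ≤ y.1 := by
  rw [← exists_pos_iff]
  constructor
  · rintro ⟨i, -, h⟩
    exact ⟨i, h⟩
  · rintro ⟨i, rfl, h⟩
    exact ⟨i, lt_blockTime_block i, rfl, h⟩

/-- The two entries of `beta i` are adjacent in the order produced by the earlier crossings of the
block. Passing `i` exchanges them, so the new order is the old one transported by the transposition.
-/
theorem front_refl_iff {i : Pos lam} {P Q : Fin n} :
    Front lam (i.1 + 1) (block i) (refl (beta i) P) (refl (beta i) Q) ↔
      Front lam i.1 (block i) P Q := by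
  have h1 := beta_fst_lt i
  have h2 := le_beta_snd i
  simp only [Front, crossed_iff, crossed_succ_iff, refl, Equiv.swap_apply_def]
  split_ifs <;> omega

theorem front_succ_iff {i : Pos lam} {P Q : Fin n} (h : beta i ≠ (P, Q)) (h' : beta i ≠ (Q, P)) :
    Front lam (i.1 + 1) (block i) P Q ↔ Front lam i.1 (block i) P Q := by
  have h1 := beta_fst_lt i
  have h2 := le_beta_snd i
  rw [Ne, Prod.ext_iff] at h h'
  dsimp only at h h'
  simp only [Front, crossed_iff, crossed_succ_iff]
  omega

theorem front_iff_of_beta {i : Pos lam} {P Q : Fin n} (h : beta i = (P, Q) ∨ beta i = (Q, P)) :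
    (Front lam i.1 (block i) P Q ↔ P < Q) ∧ (Front lam (i.1 + 1) (block i) P Q ↔ ¬ P < Q) := by
  have h1 := beta_fst_lt i
  have h2 := le_beta_snd i
  have h3 := beta_lt i
  simp only [Prod.ext_iff] at h
  simp only [Front, crossed_iff, crossed_succ_iff]
  constructor <;> omega

end Front

/-! ### Orientation, visits and heights -/

section Height

variable {n : ℕ} {lam : Shape n}

/-- `1` if the letter `α.1` precedes the letter `α.2` in the word of `w`, and `-1` otherwise. -/
def orient (w : Equiv.Perm (Fin n)) (α : Fin n × Fin n) : ℤ :=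
  if w⁻¹ α.1 < w⁻¹ α.2 then 1 else -1

theorem orient_cases (w : Equiv.Perm (Fin n)) (α : Fin n × Fin n) :
    orient w α = 1 ∨ orient w α = -1 := by
  unfold orient
  split_ifs <;> simp

theorem orient_one (α : Fin n × Fin n) : orient 1 α = sgn α := rfl

theorem mem_iSet {J : Finset (Pos lam)} {α : Fin n × Fin n} {i : Pos lam} :
    i ∈ iSet J α ↔ beta i = ((permAt J i.1)⁻¹ α.1, (permAt J i.1)⁻¹ α.2) ∨
      beta i = ((permAt J i.1)⁻¹ α.2, (permAt J i.1)⁻¹ α.1) := by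
  simp only [iSet, Finset.mem_filter, Finset.mem_univ, true_and, gam_eq, act, Prod.ext_iff,
    Equiv.Perm.eq_inv_iff_eq, Prod.fst_swap, Prod.snd_swap]

theorem permAt_succ_inv_of_mem {J : Finset (Pos lam)} {i : Pos lam} (h : i ∈ J) (x : Fin n) :
    (permAt J (i.1 + 1))⁻¹ x = refl (beta i) ((permAt J i.1)⁻¹ x) := by
  rw [permAt_succ_of_mem h, mul_inv_rev, Equiv.Perm.mul_apply]
  simp [refl]

theorem orient_succ_of_mem {J : Finset (Pos lam)} {α : Fin n × Fin n} {i : Pos lam}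
    (hi : i ∈ iSet J α) (h : i ∈ J) :
    orient (permAt J (i.1 + 1)) α = -orient (permAt J i.1) α := by
  have h3 := beta_lt i
  unfold orient
  rw [permAt_succ_inv_of_mem h, permAt_succ_inv_of_mem h]
  rcases mem_iSet.1 hi with h | h <;> rw [h] at h3 ⊢ <;> dsimp only at h3 <;>
    simp only [refl, Equiv.swap_apply_left, Equiv.swap_apply_right, h3, h3.not_gt, if_true,
      if_false, neg_neg]

theorem orient_succ_of_notMem {J : Finset (Pos lam)} {α : Fin n × Fin n} {i : Pos lam}
    (h : i ∉ J) : orient (permAt J (i.1 + 1)) α = orient (permAt J i.1) α := by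
  rw [permAt_succ_of_notMem h]

/-- Twice the value of `g_α` just before position `t`. -/
def height (J : Finset (Pos lam)) (α : Fin n × Fin n) (t : ℕ) : ℤ :=
  -orient 1 α + ∑ i ∈ (iSet J α).filter fun i => i.1 < t,
    (orient (permAt J i.1) α + orient (permAt J (i.1 + 1)) α)

theorem height_zero (J : Finset (Pos lam)) (α : Fin n × Fin n) : height J α 0 = -orient 1 α := by
  simp [height]

theorem height_succ_of_notMem {J : Finset (Pos lam)} {α : Fin n × Fin n} {i : Pos lam}
    (h : i ∉ iSet J α) : height J α (i.1 + 1) = height J α i.1 := by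
  unfold height
  congr 2
  ext x
  simp only [Finset.mem_filter, and_congr_right_iff]
  intro hx
  have : x.1 ≠ i.1 := fun he => h (Fin.ext he ▸ hx)
  omega

theorem height_succ_of_mem {J : Finset (Pos lam)} {α : Fin n × Fin n} {i : Pos lam}
    (h : i ∈ iSet J α) : height J α (i.1 + 1) =
      height J α i.1 + (orient (permAt J i.1) α + orient (permAt J (i.1 + 1)) α) := by
  have : ((iSet J α).filter fun x => x.1 < i.1 + 1) =
      insert i ((iSet J α).filter fun x => x.1 < i.1) := by
    ext x
    simp only [Finset.mem_filter, Finset.mem_insert, Fin.ext_iff]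
    constructor
    · rintro ⟨h1, h2⟩
      by_cases h3 : x.1 = i.1
      · exact Or.inl h3
      · exact Or.inr ⟨h1, by omega⟩
    · rintro (h1 | ⟨h1, h2⟩)
      · exact ⟨Fin.ext h1 ▸ h, by omega⟩
      · exact ⟨h1, by omega⟩
  rw [height, height, this, Finset.sum_insert (by simp)]
  ring

/-- The height is constant between visits. -/
theorem height_eq_of_forall_notMem {J : Finset (Pos lam)} {α : Fin n × Fin n} {t t' : ℕ}
    (htt : t ≤ t') (h : ∀ i ∈ iSet J α, t ≤ i.1 → t' ≤ i.1) :
    height J α t' = height J α t := by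
  unfold height
  congr 2
  ext x
  simp only [Finset.mem_filter, and_congr_right_iff]
  intro hx
  have := h x hx
  omega

/-- The correction of the orientation by the crossings of block `j`. -/
noncomputable def frontSign (J : Finset (Pos lam)) (α : Fin n × Fin n) (t : ℕ)
    (j : Fin (lam.1.rowLen 0)) : ℤ :=
  if Front lam t j ((permAt J t)⁻¹ α.1) ((permAt J t)⁻¹ α.2) then 1 else -1

/-- At a fold, the crossing and the exchange of letters cancel in `frontSign`, and a folded visit
has two opposite slopes. At an unfolded visit the height changes by twice the orientation while
`frontSign` turns from the orientation into its negative. -/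
theorem height_add_frontSign_succ (J : Finset (Pos lam)) (α : Fin n × Fin n) (i : Pos lam) : height J α (i.1 + 1) + frontSign J α (i.1 + 1) (block i) =
      height J α i.1 + frontSign J α i.1 (block i) := by
  by_cases hJ : i ∈ J
  · have hf : frontSign J α (i.1 + 1) (block i) = frontSign J α i.1 (block i) := by
      unfold frontSign
      rw [permAt_succ_inv_of_mem hJ, permAt_succ_inv_of_mem hJ]
      exact if_congr front_refl_iff rfl rfl
    rw [hf]
    by_cases hI : i ∈ iSet J α
    · rw [height_succ_of_mem hI, orient_succ_of_mem hI hJ]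
      ring
    · rw [height_succ_of_notMem hI]
  · by_cases hI : i ∈ iSet J α
    · rw [height_succ_of_mem hI, orient_succ_of_notMem hJ]
      obtain ⟨h1, h2⟩ := front_iff_of_beta (mem_iSet.1 hI)
      have e1 : frontSign J α i.1 (block i) = orient (permAt J i.1) α := if_congr h1 rfl rfl
      have e2 : frontSign J α (i.1 + 1) (block i) = -orient (permAt J i.1) α := by
        unfold frontSign orient
        rw [permAt_succ_of_notMem hJ, if_congr h2 rfl rfl, ite_not]
        split_ifs <;> rfl
      rw [e1, e2]
      ring
    · rw [height_succ_of_notMem hI]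
      unfold frontSign
      rw [permAt_succ_of_notMem hJ]
      rw [mem_iSet, not_or] at hI
      rw [if_congr (front_succ_iff hI.1 hI.2) rfl rfl]

theorem height_add_frontSign (J : Finset (Pos lam)) (α : Fin n × Fin n)
    {j : Fin (lam.1.rowLen 0)} {t : ℕ} (h1 : blockTime lam j.1 ≤ t)
    (h2 : t ≤ blockTime lam (j.1 + 1)) :
    height J α t + frontSign J α t j =
      height J α (blockTime lam j.1) + orient (permAt J (blockTime lam j.1)) α := by
  refine time_induction (P := fun t => height J α t + frontSign J α t j = _)
    (blockTime_le (j.1 + 1)) ?_ ?_ h1 h2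
  · simp [frontSign, Front, not_crossed_blockTime, orient]
  · intro i h1 h2 ih
    obtain rfl : block i = j := Fin.ext (block_eq h1 h2)
    rw [height_add_frontSign_succ, ih]

/-- The number of letters `α.1` minus the number of letters `α.2` in a column. -/
def colSign (α : Fin n × Fin n) (b : Filling lam) (j : Fin (lam.1.rowLen 0)) : ℤ :=
  (if ∃ x, b j x = α.1 then 1 else 0) - (if ∃ x, b j x = α.2 then 1 else 0)

/-- The number of letters `α.1` minus the number of letters `α.2` in the first `t` columns. -/
def content (α : Fin n × Fin n) (b : Filling lam) (t : ℕ) : ℤ :=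
  ∑ j ∈ Finset.univ.filter fun j : Fin (lam.1.rowLen 0) => j.1 < t, colSign α b j

theorem content_zero (α : Fin n × Fin n) (b : Filling lam) : content α b 0 = 0 := by
  simp [content]

theorem sum_filter_lt_succ {N : ℕ} {M : Type*} [AddCommMonoid M] (f : Fin N → M) (j : Fin N) :
    ∑ x ∈ Finset.univ.filter (fun x : Fin N => x.1 < j.1 + 1), f x =
      ∑ x ∈ Finset.univ.filter (fun x : Fin N => x.1 < j.1), f x + f j := by
  have : Finset.univ.filter (fun x : Fin N => x.1 < j.1 + 1) =
      insert j (Finset.univ.filter fun x : Fin N => x.1 < j.1) := by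
    ext x
    simp only [Finset.mem_filter, Finset.mem_univ, true_and, Finset.mem_insert, Fin.ext_iff]
    omega
  rw [this, Finset.sum_insert (by simp), add_comm]

theorem content_succ (α : Fin n × Fin n) (b : Filling lam) (j : Fin (lam.1.rowLen 0)) :
    content α b (j.1 + 1) = content α b j.1 + colSign α b j :=
  sum_filter_lt_succ _ j

theorem exists_sortCol {r : ℕ} {c : Fin r → Fin n} {y : Fin n} :
    (∃ x, sortCol c x = y) ↔ ∃ x, c x = y := by
  unfold sortCol
  constructor
  · rintro ⟨x, h⟩
    exact ⟨_, h⟩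
  · rintro ⟨x, h⟩
    exact ⟨(Tuple.sort c).symm x, by simpa using h⟩

theorem exists_fill {J : Finset (Pos lam)} {j : Fin (lam.1.rowLen 0)} {y : Fin n} :
    (∃ x, fill J j x = y) ↔
      ((permAt J (blockTime lam (j.1 + 1)))⁻¹ y).1 < lam.1.colLen j := by
  unfold fill
  rw [blockPerm_eq]
  constructor
  · rintro ⟨x, rfl⟩
    simp
  · intro h
    refine ⟨⟨_, h⟩, ?_⟩
    rw [← Equiv.Perm.eq_inv_iff_eq]
    rfl

theorem exists_sfill {J : Finset (Pos lam)} {j : Fin (lam.1.rowLen 0)} {y : Fin n} :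
    (∃ x, sfill J j x = y) ↔
      ((permAt J (blockTime lam (j.1 + 1)))⁻¹ y).1 < lam.1.colLen j := by
  rw [← exists_fill]
  exact exists_sortCol

/-- A complete block has crossed exactly the pairs with one position inside the column and one
outside. So the sign is corrected precisely when the column contains just one of the two letters. -/
theorem frontSign_blockTime_succ {J : Finset (Pos lam)} {α : Fin n × Fin n} (hα : α.1 ≠ α.2)
    (j : Fin (lam.1.rowLen 0)) : frontSign J α (blockTime lam (j.1 + 1)) j =
      orient (permAt J (blockTime lam (j.1 + 1))) α - 2 * colSign α (sfill J) j := by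
  unfold frontSign orient colSign Front
  simp only [crossed_blockTime_succ, exists_sfill]
  have hne := (permAt J (blockTime lam (j.1 + 1)))⁻¹.injective.ne hα
  generalize (permAt J (blockTime lam (j.1 + 1)))⁻¹ α.1 = P at *
  generalize (permAt J (blockTime lam (j.1 + 1)))⁻¹ α.2 = Q at *
  split_ifs <;> omega

/-- The height at the end of a block, in terms of the content of the filling. -/
theorem height_blockTime {J : Finset (Pos lam)} {α : Fin n × Fin n} (hα : α.1 ≠ α.2)
    {j : ℕ} (hj : j ≤ lam.1.rowLen 0) :
    height J α (blockTime lam j) + orient (permAt J (blockTime lam j)) α =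
      2 * content α (sfill J) j := by
  induction j with
  | zero => simp [blockTime_zero, height_zero, permAt_zero, content_zero]
  | succ j ih =>
    have h1 := height_add_frontSign J α (j := ⟨j, hj⟩)
      (blockTime_mono (Nat.le_succ j)) le_rfl
    have h2 := frontSign_blockTime_succ (J := J) hα ⟨j, hj⟩
    have h3 := content_succ α (sfill J) ⟨j, hj⟩
    have h4 := ih (by omega)
    dsimp only at h1 h2 h3 h4
    linarith

/-- The height at a visit, in terms of the content of the filling. -/
theorem height_of_mem {J : Finset (Pos lam)} {α : Fin n × Fin n} (hα : α.1 ≠ α.2)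
    {i : Pos lam} (hi : i ∈ iSet J α) :
    height J α i.1 + orient (permAt J i.1) α = 2 * content α (sfill J) (block i).1 := by
  have h1 := height_add_frontSign J α (blockTime_block_le i) (lt_blockTime_block i).le
  have h2 : frontSign J α i.1 (block i) = orient (permAt J i.1) α := by
    unfold frontSign orient
    exact if_congr (front_iff_of_beta (mem_iSet.1 hi)).1 rfl rfl
  rw [← h2, h1, height_blockTime hα (block i).2.le]

end Height

/-! ### Consequences of admissibility -/

section Admissible

variable {n : ℕ} {lam : Shape n}

theorem Admissible.edge {J : Finset (Pos lam)} (hJ : Admissible J) {i : Pos lam} (h : i ∈ J) :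
    QBEdge (permAt J i.1) ((beta i).1, (beta i).2) := by
  rw [← foldPerm_before]
  exact hJ i h

variable [NeZero n]

/-- The letters of `α_p` can only be brought out of order by a folding at `α_p` itself. -/
theorem Admissible.mem_of_orient {J : Finset (Pos lam)} (hJ : Admissible J) {p : Fin n}
    {i : Pos lam} (h1 : orient (permAt J i.1) (crystalRoot p) = 1)
    (h2 : orient (permAt J (i.1 + 1)) (crystalRoot p) = -1) :
    i ∈ iSet J (crystalRoot p) ∧ i ∈ J := by
  have hiJ : i ∈ J := by
    by_contra h
    rw [orient_succ_of_notMem h, h1] at h2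
    omega
  refine ⟨?_, hiJ⟩
  by_contra hI
  rw [mem_iSet, not_or, Prod.ext_iff, Prod.ext_iff] at hI
  dsimp only at hI
  have hlt := beta_lt i
  -- A fold moving only one of the letters can reverse `α_p.1`, `α_p.2` in two ways: `α_p.1` jumps
  -- right over `α_p.2`, or `α_p.2` jumps left over `α_p.1`. The edge condition forbids both.
  have hl : ∀ c, (beta i).1 < c → c < (beta i).2 →
      (permAt J i.1)⁻¹ (crystalRoot p).1 = (beta i).1 →
      (permAt J i.1)⁻¹ (crystalRoot p).2 ≠ c := by
    intro c h3 h4 h5 h6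
    rw [Equiv.Perm.inv_eq_iff_eq] at h5 h6
    exact (hJ.edge hiJ).crystal_left h5.symm h3 h4 h6.symm
  have hr : ∀ c, (beta i).1 < c → c < (beta i).2 →
      (permAt J i.1)⁻¹ (crystalRoot p).2 = (beta i).2 →
      (permAt J i.1)⁻¹ (crystalRoot p).1 ≠ c := by
    intro c h3 h4 h5 h6
    rw [Equiv.Perm.inv_eq_iff_eq] at h5 h6
    exact (hJ.edge hiJ).crystal_right h5.symm h3 h4 h6.symm
  unfold orient at h1 h2
  rw [permAt_succ_inv_of_mem hiJ, permAt_succ_inv_of_mem hiJ] at h2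
  generalize (permAt J i.1)⁻¹ (crystalRoot p).1 = P at *
  generalize (permAt J i.1)⁻¹ (crystalRoot p).2 = Q at *
  have hl' := hl Q
  have hr' := hr P
  simp only [refl, Equiv.swap_apply_def] at h2
  split_ifs at h1 h2 <;> omega

/-- After an unfolded visit in positive direction there is no other visit in the same block. -/
theorem Admissible.block_lt {J : Finset (Pos lam)} (hJ : Admissible J) {p : Fin n}
    {i i' : Pos lam} (hi : i ∈ iSet J (crystalRoot p)) (hi' : i' ∈ iSet J (crystalRoot p))
    (hiJ : i ∉ J) (h1 : orient (permAt J i.1) (crystalRoot p) = 1) (hlt : i < i') :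
    block i < block i' := by
  by_contra hb
  have hbe : block i = block i' := le_antisymm (block_mono hlt.le) (not_lt.1 hb)
  have hbeta : beta i = ((permAt J i.1)⁻¹ (crystalRoot p).1, (permAt J i.1)⁻¹ (crystalRoot p).2) := by
    refine (mem_iSet.1 hi).resolve_right fun h => ?_
    have := beta_lt i
    rw [h] at this
    rw [orient, if_neg this.not_gt] at h1
    omega
  -- Both letters stay in the positions of `beta i` for the rest of the block, so another visit
  -- there would have to repeat the root `beta i`.
  have key : (permAt J i'.1)⁻¹ (crystalRoot p).1 = (beta i).1 ∧
      (permAt J i'.1)⁻¹ (crystalRoot p).2 = (beta i).2 := by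
    refine time_induction (P := fun t => (permAt J t)⁻¹ (crystalRoot p).1 = (beta i).1 ∧
      (permAt J t)⁻¹ (crystalRoot p).2 = (beta i).2) (t₀ := i.1 + 1) i'.2.le ?_ ?_ hlt le_rfl
    · rw [permAt_succ_of_notMem hiJ, hbeta]
      exact ⟨rfl, rfl⟩
    · rintro k hik hki ⟨hP, hQ⟩
      by_cases hk : k ∈ J
      · have hbk : block i = block k := le_antisymm (block_mono (Fin.le_def.2 (by omega)))
          (hbe ▸ block_mono (Fin.le_def.2 hki.le))
        have hlex := (chain_lex (show i < k from hik)).resolve_left hbk.not_lt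
        have e1 := beta_fst_lt i
        have e2 := le_beta_snd i
        have e3 := beta_fst_lt k
        have e4 := le_beta_snd k
        rw [hbk] at e1 e2
        rw [permAt_succ_inv_of_mem hk, permAt_succ_inv_of_mem hk, hP, hQ]
        have hP' := Equiv.Perm.inv_eq_iff_eq.1 hP
        have hQ' := Equiv.Perm.inv_eq_iff_eq.1 hQ
        -- Later in the block, an equal first entry comes with a larger second entry, which puts
        -- `α_p.2` strictly inside the folded interval. Likewise an equal second entry comes with a
        -- smaller first entry, which puts `α_p.1` inside.
        have hl : (beta i).1 ≠ (beta k).1 := by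
          intro h
          rw [h] at hP'
          exact (hJ.edge hk).crystal_left hP'.symm (c := (beta i).2) (by omega) (by omega)
            hQ'.symm
        have hr : (beta i).2 ≠ (beta k).2 := by
          intro h
          rw [h] at hQ'
          exact (hJ.edge hk).crystal_right hQ'.symm (c := (beta i).1) (by omega) (by omega)
            hP'.symm
        simp only [refl, Equiv.swap_apply_def]
        split_ifs <;> omega
      · rw [permAt_succ_of_notMem hk]
        exact ⟨hP, hQ⟩
  have h3 := beta_lt i
  have h4 := beta_lt i'
  rcases mem_iSet.1 hi' with h | h <;> rw [key.1, key.2] at h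
  · exact hlt.ne (pos_ext hbe h.symm)
  · rw [h] at h4
    exact lt_asymm h3 h4

end Admissible

/-! ### The heights `l_i^Δ` and the content of the sorted filling -/

section Level

variable {n : ℕ} {lam : Shape n}

/-- The number of columns among the first `t` that have an entry in row `y`. -/
def rowCount (lam : Shape n) (t : ℕ) (y : Fin n) : ℤ :=
  ∑ j ∈ Finset.univ.filter (fun j : Fin (lam.1.rowLen 0) => j.1 < t),
    if y.1 < lam.1.colLen j then 1 else 0

/-- The number of columns among the first `t` that contain the letter `x`. -/
def letterCount (b : Filling lam) (t : ℕ) (x : Fin n) : ℤ :=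
  ∑ j ∈ Finset.univ.filter (fun j : Fin (lam.1.rowLen 0) => j.1 < t),
    if ∃ z, b j z = x then 1 else 0

theorem pair_letterCount (b : Filling lam) (t : ℕ) (α : Fin n × Fin n) :
    pair (letterCount b t) α = content α b t :=
  (Finset.sum_sub_distrib _ _).symm

/-- The root `(a, b)` occurs once in the block of each column that reaches row `a` but not row `b`.
-/
theorem lvl_eq (i : Pos lam) :
    (lvl i : ℤ) = rowCount lam (block i).1 (beta i).1 - rowCount lam (block i).1 (beta i).2 := by
  have hcard : lvl i = ((Finset.univ.filter fun j : Fin (lam.1.rowLen 0) => j.1 < (block i).1).filter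
      fun j : Fin (lam.1.rowLen 0) => (beta i).1.1 < lam.1.colLen j ∧ lam.1.colLen j ≤ (beta i).2.1).card := by
    refine Finset.card_bij (fun i' _ => block i') ?_ ?_ ?_
    · intro i' hi'
      simp only [Finset.mem_filter, Finset.mem_univ, true_and] at hi' ⊢
      refine ⟨?_, hi'.2 ▸ beta_fst_lt i', hi'.2 ▸ le_beta_snd i'⟩
      exact lt_of_le_of_ne (block_mono hi'.1.le) fun h => hi'.1.ne (pos_ext (Fin.ext h) hi'.2)
    · intro i₁ h₁ i₂ h₂ h
      simp only [Finset.mem_filter, Finset.mem_univ, true_and] at h₁ h₂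
      exact pos_ext h (h₁.2.trans h₂.2.symm)
    · intro j hj
      simp only [Finset.mem_filter, Finset.mem_univ, true_and] at hj
      obtain ⟨i', rfl, h⟩ := exists_pos_iff.2 hj.2
      refine ⟨i', ?_, rfl⟩
      simp only [Finset.mem_filter, Finset.mem_univ, true_and]
      exact ⟨lt_of_not_ge fun hle => (block_mono hle).not_gt hj.1, h⟩
  rw [hcard, Finset.card_filter]
  unfold rowCount
  rw [← Finset.sum_sub_distrib]
  push_cast
  refine Finset.sum_congr rfl fun j _ => ?_
  have := beta_lt i
  split_ifs <;> omega

theorem foldAff_cut_succ_of_mem {J : Finset (Pos lam)} {i : Pos lam} (h : i ∈ J) (v : Fin n → ℤ) :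
    foldAff (cut J (i.1 + 1)) v =
      foldAff (cut J i.1) (affRefl (beta i) (-(lvl i : ℤ)) v) := by
  simp [foldAff, sort_cut_succ_of_mem h]

/-- Equivalently, adding the row counts of the preceding columns conjugates `s_{β_i,-l_i}` into the
linear reflection `s_{β_i}`. -/
theorem rowCount_refl (i : Pos lam) (y : Fin n) :
    rowCount lam (block i).1 (refl (beta i) y) =
      rowCount lam (block i).1 y + -(lvl i : ℤ) * rootVec ℤ (beta i) y := by
  have hne := (beta_lt i).ne
  rw [lvl_eq]
  simp only [refl, Equiv.swap_apply_def, rootVec, Pi.sub_apply, Pi.single_apply]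
  split_ifs with h1 h2 h2
  · exact absurd (h1.symm.trans h2) hne
  · rw [h1]
    ring
  · rw [h2]
    ring
  · ring

theorem rowCount_succ (j : Fin (lam.1.rowLen 0)) (y : Fin n) :
    rowCount lam (j.1 + 1) y = rowCount lam j.1 y + if y.1 < lam.1.colLen j then 1 else 0 :=
  sum_filter_lt_succ _ j

theorem letterCount_succ (J : Finset (Pos lam)) (j : Fin (lam.1.rowLen 0)) (x : Fin n) :
    letterCount (sfill J) (j.1 + 1) x = letterCount (sfill J) j.1 x +
      if ((permAt J (blockTime lam (j.1 + 1)))⁻¹ x).1 < lam.1.colLen j then 1 else 0 := by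
  unfold letterCount
  rw [sum_filter_lt_succ]
  simp only [exists_sfill]

/-- All affine reflections of one block become linear after the same shift by row counts, so inside
the block only the permutation changes. -/
theorem foldAff_cut_of_blockTime {J : Finset (Pos lam)} {j : Fin (lam.1.rowLen 0)}
    (h : ∀ v x, foldAff (cut J (blockTime lam j.1)) v x =
      v ((permAt J (blockTime lam j.1))⁻¹ x) +
        (rowCount lam j.1 ((permAt J (blockTime lam j.1))⁻¹ x) - letterCount (sfill J) j.1 x))
    {t : ℕ} (h1 : blockTime lam j.1 ≤ t) (h2 : t ≤ blockTime lam (j.1 + 1)) (v : Fin n → ℤ)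
    (x : Fin n) : foldAff (cut J t) v x = v ((permAt J t)⁻¹ x) +
      (rowCount lam j.1 ((permAt J t)⁻¹ x) - letterCount (sfill J) j.1 x) := by
  refine time_induction (P := fun t => ∀ v x, foldAff (cut J t) v x = v ((permAt J t)⁻¹ x) +
    (rowCount lam j.1 ((permAt J t)⁻¹ x) - letterCount (sfill J) j.1 x))
    (blockTime_le (j.1 + 1)) h ?_ h1 h2 v x
  intro i h1 h2 ih v x
  by_cases hi : i ∈ J
  · obtain rfl : block i = j := Fin.ext (block_eq h1 h2)
    rw [foldAff_cut_succ_of_mem hi, ih, permAt_succ_inv_of_mem hi, rowCount_refl, affRefl_apply]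
    have : (refl (beta i))⁻¹ = refl (beta i) := by simp [refl]
    rw [this]
    push_cast
    ring
  · rw [cut_succ_of_notMem hi, permAt_succ_of_notMem hi, ih]

/-- When a block ends, its column increases the row count at the position of `x` exactly when it
contains the letter `x`, so the formula carries over to the next block. -/
theorem foldAff_cut_blockTime (J : Finset (Pos lam)) {j : ℕ} (hj : j ≤ lam.1.rowLen 0)
    (v : Fin n → ℤ) (x : Fin n) : foldAff (cut J (blockTime lam j)) v x =
      v ((permAt J (blockTime lam j))⁻¹ x) +
        (rowCount lam j ((permAt J (blockTime lam j))⁻¹ x) - letterCount (sfill J) j x) := by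
  induction j generalizing v x with
  | zero => simp [blockTime_zero, cut_zero, permAt_zero, foldAff, rowCount, letterCount]
  | succ j ih =>
    have h1 := foldAff_cut_of_blockTime (j := ⟨j, hj⟩) (ih (by omega))
      (blockTime_mono (Nat.le_succ j)) le_rfl v x
    have h2 := letterCount_succ J ⟨j, hj⟩ x
    have h3 := rowCount_succ ⟨j, hj⟩ ((permAt J (blockTime lam (j + 1)))⁻¹ x)
    dsimp only at h1 h2 h3
    rw [Nat.succ_eq_add_one] at h1
    rw [h1, h2, h3]
    ring

theorem foldAff_cut (J : Finset (Pos lam)) (i : Pos lam) (v : Fin n → ℤ) (x : Fin n) :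
    foldAff (cut J i.1) v x = v ((permAt J i.1)⁻¹ x) +
      (rowCount lam (block i).1 ((permAt J i.1)⁻¹ x) - letterCount (sfill J) (block i).1 x) :=
  foldAff_cut_of_blockTime (foldAff_cut_blockTime J (block i).2.le) (blockTime_block_le i)
    (lt_blockTime_block i).le v x

theorem sgn_mul_self (α : Fin n × Fin n) : sgn α * sgn α = 1 := by
  unfold sgn
  split_ifs <;> rfl

theorem sgn_swap {α : Fin n × Fin n} (hα : α.1 ≠ α.2) : sgn α.swap = -sgn α := by
  unfold sgn
  simp only [Prod.fst_swap, Prod.snd_swap]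
  split_ifs <;> omega

theorem pair_swap (v : Fin n → ℤ) (α : Fin n × Fin n) : pair v α.swap = -pair v α := by
  simp [pair]

theorem pair_absRoot (v : Fin n → ℤ) (α : Fin n × Fin n) :
    pair v (absRoot α) = sgn α * pair v α := by
  unfold absRoot sgn
  split_ifs
  · ring
  · rw [pair_swap]
    ring

/-- For `β_i = (a, b)`, the point `-l_i ε_a` shifted by the row counts has equal coordinates at `a`
and `b`; only the letter counts survive the pairing. -/
theorem foldLvl_eq (J : Finset (Pos lam)) (i : Pos lam) :
    foldLvl J i = pair (letterCount (sfill J) (block i).1) (absRoot (gam J i)) := by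
  have hne := (beta_lt i).ne'
  have hinv : ∀ x, (permAt J i.1)⁻¹ (permAt J i.1 x) = x := fun x => by simp
  unfold foldLvl
  rw [pair_absRoot, pair_absRoot, before_eq_cut, gam_eq]
  simp only [pair, act, foldAff_cut, hinv, Pi.single_eq_same,
    Pi.single_eq_of_ne hne, lvl_eq]
  ring

/-- The row counts of all columns together are the parts of `λ` and cancel the argument `-λ`. -/
theorem mu_eq (J : Finset (Pos lam)) : mu J = letterCount (sfill J) (lam.1.rowLen 0) := by
  have hrow : ∀ y : Fin n, rowCount lam (lam.1.rowLen 0) y = weight lam y := by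
    intro y
    unfold rowCount weight
    rw [Finset.filter_true_of_mem fun j _ => j.2, Finset.sum_boole]
    have : (Finset.univ.filter fun j : Fin (lam.1.rowLen 0) => y.1 < lam.1.colLen j) =
        Finset.univ.filter fun j : Fin (lam.1.rowLen 0) => j.1 < lam.1.rowLen y := by
      ext j
      rw [Finset.mem_filter, Finset.mem_filter, ← YoungDiagram.mem_iff_lt_colLen,
        ← YoungDiagram.mem_iff_lt_rowLen]
    rw [this, Fin.card_filter_val_lt, min_eq_right (lam.1.rowLen_anti 0 y (Nat.zero_le _))]
  funext x
  have h := foldAff_cut_blockTime J le_rfl (-weight lam) x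
  rw [blockTime_last le_rfl, cut_length, hrow] at h
  rw [mu, Pi.neg_apply, h, Pi.neg_apply]
  ring

theorem sgn_mul_hatLvl_coe {J : Finset (Pos lam)} {α : Fin n × Fin n} (hα : α.1 ≠ α.2)
    {i : Pos lam} (hi : i ∈ iSet J α) :
    sgn α * hatLvl J α (WithTop.some i) = content α (sfill J) (block i).1 := by
  have h : hatLvl J α (WithTop.some i) = foldLvl J i := rfl
  rw [h, foldLvl_eq, pair_absRoot, ← pair_letterCount, ← mul_assoc]
  simp only [iSet, Finset.mem_filter, Finset.mem_univ, true_and] at hi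
  rcases hi with h | h <;> rw [h]
  · rw [sgn_mul_self, one_mul]
  · rw [sgn_swap hα, pair_swap, mul_neg, mul_neg, neg_mul, neg_neg, sgn_mul_self, one_mul]

theorem sgn_mul_hatLvl_top (J : Finset (Pos lam)) (α : Fin n × Fin n) :
    sgn α * hatLvl J α ⊤ = content α (sfill J) (lam.1.rowLen 0) := by
  have h : hatLvl J α ⊤ = sgn α * pair (mu J) α := rfl
  rw [h, ← mul_assoc, sgn_mul_self, one_mul, mu_eq, pair_letterCount]

end Level

/-! ### The values of `g_α` -/

section Graph

variable {n : ℕ} {lam : Shape n}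

/-- Twice the values of `g_α` at its break points before time `t`. -/
def ValueBefore (J : Finset (Pos lam)) (α : Fin n × Fin n) (t : ℕ) (v : ℤ) : Prop :=
  (∃ t' ≤ t, v = height J α t') ∨
    ∃ i ∈ iSet J α, i.1 < t ∧ v = height J α i.1 + orient (permAt J i.1) α

/-- Twice the values of `g_α` at its break points. -/
def GraphValue (J : Finset (Pos lam)) (α : Fin n × Fin n) (v : ℤ) : Prop :=
  ValueBefore J α (chain lam).length v ∨
    v = height J α (chain lam).length + orient (permAt J (chain lam).length) α

/-- The slopes of `g_α` before time `t`. -/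
def slopesAt (J : Finset (Pos lam)) (α : Fin n × Fin n) (t : ℕ) : List ℤ :=
  (cut (iSet J α) t).sort.flatMap fun i =>
    [orient (permAt J i.1) α, orient (permAt J (i.1 + 1)) α]

theorem slopesAt_succ_of_mem {J : Finset (Pos lam)} {α : Fin n × Fin n} {i : Pos lam}
    (h : i ∈ iSet J α) : slopesAt J α (i.1 + 1) =
      slopesAt J α i.1 ++ [orient (permAt J i.1) α] ++ [orient (permAt J (i.1 + 1)) α] := by
  simp [slopesAt, sort_cut_succ_of_mem h]

theorem slopesAt_succ_of_notMem {J : Finset (Pos lam)} {α : Fin n × Fin n} {i : Pos lam}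
    (h : i ∉ iSet J α) : slopesAt J α (i.1 + 1) = slopesAt J α i.1 := by
  simp [slopesAt, cut_succ_of_notMem h]

/-- Break points of `g_α` correspond to prefixes of the list of slopes. The shift by `orient 1 α`
makes up for the starting height `-orient 1 α`. -/
theorem slopesAt_spec (J : Finset (Pos lam)) (α : Fin n × Fin n) {t : ℕ}
    (ht : t ≤ (chain lam).length) : (slopesAt J α t).sum = height J α t + orient 1 α ∧
      ∀ v, (∃ l, l <+: slopesAt J α t ∧ l.sum = v + orient 1 α) ↔ ValueBefore J α t v := by
  refine time_induction (P := fun t => (slopesAt J α t).sum = height J α t + orient 1 α ∧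
      ∀ v, (∃ l, l <+: slopesAt J α t ∧ l.sum = v + orient 1 α) ↔ ValueBefore J α t v)
    le_rfl ?_ ?_ (Nat.zero_le t) ht
  · have h0 : slopesAt J α 0 = [] := by simp [slopesAt, cut_zero]
    rw [h0]
    refine ⟨by simp [height_zero], fun v => ?_⟩
    simp only [List.prefix_nil, exists_eq_left, List.sum_nil, ValueBefore, Nat.le_zero,
      height_zero, Nat.not_lt_zero, false_and, and_false, exists_false, or_false]
    omega
  · rintro i - - ⟨ih1, ih2⟩
    by_cases hi : i ∈ iSet J α
    · have hh := height_succ_of_mem hi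
      rw [slopesAt_succ_of_mem hi]
      refine ⟨by simp [ih1, hh]; ring, fun v => ?_⟩
      have hsplit : (∃ l, l <+: slopesAt J α i.1 ++ [orient (permAt J i.1) α] ++
          [orient (permAt J (i.1 + 1)) α] ∧ l.sum = v + orient 1 α) ↔
          v = height J α (i.1 + 1) ∨ v = height J α i.1 + orient (permAt J i.1) α ∨
            ValueBefore J α i.1 v := by
        rw [← ih2]
        simp only [List.prefix_concat_iff, or_and_right, exists_or, exists_eq_left,
          List.sum_append, List.sum_singleton, ih1]
        refine or_congr (by omega) (or_congr (by omega) Iff.rfl)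
      rw [hsplit]
      constructor
      · rintro (h | h | ⟨t', h1, h2⟩ | ⟨i', h1, h2, h3⟩)
        · exact Or.inl ⟨_, le_rfl, h⟩
        · exact Or.inr ⟨i, hi, Nat.lt_succ_self _, h⟩
        · exact Or.inl ⟨t', by omega, h2⟩
        · exact Or.inr ⟨i', h1, by omega, h3⟩
      · rintro (⟨t', h1, h2⟩ | ⟨i', h1, h2, h3⟩)
        · rcases Nat.le_succ_iff.1 h1 with h4 | rfl
          · exact Or.inr (Or.inr (Or.inl ⟨t', h4, h2⟩))
          · exact Or.inl h2
        · rcases Nat.lt_succ_iff_lt_or_eq.1 h2 with h4 | h4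
          · exact Or.inr (Or.inr (Or.inr ⟨i', h1, h4, h3⟩))
          · obtain rfl := Fin.ext h4
            exact Or.inr (Or.inl h3)
    · have hh := height_succ_of_notMem hi
      rw [slopesAt_succ_of_notMem hi, hh]
      refine ⟨ih1, fun v => ?_⟩
      rw [ih2]
      constructor
      · rintro (⟨t', h1, h2⟩ | ⟨i', h1, h2, h3⟩)
        · exact Or.inl ⟨t', by omega, h2⟩
        · exact Or.inr ⟨i', h1, by omega, h3⟩
      · rintro (⟨t', h1, h2⟩ | ⟨i', h1, h2, h3⟩)
        · rcases Nat.le_succ_iff.1 h1 with h4 | rfl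
          · exact Or.inl ⟨t', h4, h2⟩
          · exact Or.inl ⟨i.1, le_rfl, h2.trans hh⟩
        · rcases Nat.lt_succ_iff_lt_or_eq.1 h2 with h4 | h4
          · exact Or.inr ⟨i', h1, h4, h3⟩
          · exact absurd (Fin.ext h4 ▸ h1) hi

theorem iSet_absRoot (J : Finset (Pos lam)) (α : Fin n × Fin n) :
    iSet J (absRoot α) = iSet J α := by
  unfold absRoot
  split_ifs
  · rfl
  · ext i
    simp [iSet, or_comm]

theorem sgn_mul_sgn_gam {J : Finset (Pos lam)} {α : Fin n × Fin n} (hα : α.1 ≠ α.2)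
    {i : Pos lam} (hi : i ∈ iSet J α) :
    sgn α * sgn (gam J i) = orient (permAt J i.1) α := by
  have h3 := beta_lt i
  have h4 := mem_iSet.1 hi
  simp only [iSet, Finset.mem_filter, Finset.mem_univ, true_and] at hi
  have hne := (permAt J i.1)⁻¹.injective.ne hα
  rw [gam_eq] at hi ⊢
  unfold orient
  rcases h4 with h | h <;> rw [h] at h3 ⊢ <;> dsimp only at h3
  · have : act (permAt J i.1) ((permAt J i.1)⁻¹ α.1, (permAt J i.1)⁻¹ α.2) = α := by simp [act]
    rw [this, sgn_mul_self, if_pos h3]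
  · have : act (permAt J i.1) ((permAt J i.1)⁻¹ α.2, (permAt J i.1)⁻¹ α.1) = α.swap := by
      simp [act, Prod.swap]
    rw [this, sgn_swap hα, mul_neg, sgn_mul_self, if_neg h3.not_gt]

theorem sgn_mul_sign_gamInf (J : Finset (Pos lam)) {α : Fin n × Fin n} (hα : α.1 ≠ α.2) :
    sgn α * Int.sign (pair (gamInf J) (absRoot α)) =
      orient (permAt J (chain lam).length) α := by
  have hs : ∀ z : ℤ, sgn α * Int.sign (sgn α * z) = Int.sign z := by
    intro z
    unfold sgn
    split_ifs <;> simp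
  rw [pair_absRoot, hs, permAt_length]
  unfold orient
  have hne := (foldPerm J)⁻¹.injective.ne hα
  simp only [pair, gamInf, actVec, rho]
  generalize (foldPerm J)⁻¹ α.1 = P at *
  generalize (foldPerm J)⁻¹ α.2 = Q at *
  split_ifs with h
  · rw [Int.sign_eq_one_iff_pos]
    omega
  · rw [Int.sign_eq_neg_one_iff_neg]
    omega

/-- Once the factor `sgn α` is absorbed, every slope is an orientation, and `α_0 < 0` needs no
separate treatment. -/
theorem map_slopes (J : Finset (Pos lam)) {α : Fin n × Fin n} (hα : α.1 ≠ α.2) :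
    (slopes J (absRoot α)).map (sgn α * ·) =
      slopesAt J α (chain lam).length ++ [orient (permAt J (chain lam).length) α] := by
  unfold slopes slopesAt
  rw [List.map_append, List.map_singleton, sgn_mul_sign_gamInf J hα, iSet_absRoot, cut_length,
    List.map_flatMap]
  congr 1
  refine List.flatMap_congr fun i hi => ?_
  rw [Finset.mem_sort] at hi
  have h := sgn_mul_sgn_gam hα hi
  simp only [List.map_cons, List.map_nil, h]
  split_ifs with hJ
  · rw [orient_succ_of_mem hi hJ, ← h]
    simp
  · rw [orient_succ_of_notMem hJ, ← h]
    simp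

theorem two_mul_graph (J : Finset (Pos lam)) {α : Fin n × Fin n} (t : ℕ) :
    2 * graph J α t =
      ((((slopes J (absRoot α)).map (sgn α * ·)).take t).sum - orient 1 α : ℤ) := by
  rw [← List.map_take, List.sum_map_mul_left, List.map_id', orient_one, graph]
  push_cast
  ring

theorem graph_values (J : Finset (Pos lam)) {α : Fin n × Fin n} (hα : α.1 ≠ α.2) (v : ℤ) :
    (∃ t < (slopes J (absRoot α)).length + 1, 2 * graph J α t = v) ↔ GraphValue J α v := by
  obtain ⟨h1, h2⟩ := slopesAt_spec J α (le_refl (chain lam).length)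
  have hl : (∃ t < (slopes J (absRoot α)).length + 1, 2 * graph J α t = v) ↔
      ∃ l, l <+: slopesAt J α (chain lam).length ++ [orient (permAt J (chain lam).length) α] ∧
        l.sum = v + orient 1 α := by
    rw [← map_slopes J hα]
    constructor
    · rintro ⟨t, -, h⟩
      refine ⟨_, List.take_prefix t _, ?_⟩
      rw [two_mul_graph, Int.cast_inj] at h
      omega
    · rintro ⟨l, hl, h⟩
      refine ⟨l.length, ?_, ?_⟩
      · have := hl.length_le
        rw [List.length_map] at this
        omega
      · rw [two_mul_graph, ← List.prefix_iff_eq_take.1 hl, h, add_sub_cancel_right]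
  rw [hl, GraphValue, ← h2]
  simp only [List.prefix_concat_iff, or_and_right, exists_or, exists_eq_left,
          List.sum_append, List.sum_singleton, h1]
  rw [or_comm]
  refine or_congr Iff.rfl (by omega)

/-- Twice the maximum of `g_α` is the largest of the integers `GraphValue`. -/
theorem exists_graphMax (J : Finset (Pos lam)) {α : Fin n × Fin n} (hα : α.1 ≠ α.2) :
    ∃ z : ℤ, 2 * graphMax J α = z ∧ GraphValue J α z ∧ ∀ v, GraphValue J α v → v ≤ z := by
  obtain ⟨t, ht, h⟩ := Finset.exists_mem_eq_sup' (s := Finset.range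
    ((slopes J (absRoot α)).length + 1)) ⟨0, by simp⟩ (graph J α)
  rw [Finset.mem_range] at ht
  have h' : 2 * graphMax J α = _ := (congrArg (2 * ·) h).trans (two_mul_graph J t)
  refine ⟨_, h', (graph_values J hα _).1 ⟨t, ht, two_mul_graph J t⟩, fun v hv => ?_⟩
  obtain ⟨t', ht', h''⟩ := (graph_values J hα v).2 hv
  have hle : graph J α t' ≤ graphMax J α :=
    Finset.le_sup' (graph J α) (Finset.mem_range.2 ht')
  have : (v : ℚ) ≤ _ := (h''.symm.trans_le (mul_le_mul_of_nonneg_left hle (by norm_num))).trans_eq h'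
  exact_mod_cast this

end Graph

/-! ### The signature rule -/

section Reduction

variable {β : Type*}

/-- The signs `+` of the reduced form of a word. -/
def plusSigns (l : List (Bool × β)) : List (Bool × β) := (l.foldr push []).filter fun s => s.1

theorem pairwise_push {s : Bool × β} {w : List (Bool × β)}
    (h : w.Pairwise fun s t => s.1 = false → t.1 = false) :
    (push s w).Pairwise fun s t => s.1 = false → t.1 = false := by
  cases w with
  | nil => exact List.pairwise_singleton _ _
  | cons t w =>
    simp only [push]
    split_ifs with hs
    · exact (List.pairwise_cons.1 h).2
    · refine List.pairwise_cons.2 ⟨fun u hu h1 => ?_, h⟩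
      have ht : t.1 = false := by simpa [h1] using hs
      rcases List.mem_cons.1 hu with rfl | hu
      · exact ht
      · exact (List.pairwise_cons.1 h).1 u hu ht

theorem pairwise_foldr_push (l : List (Bool × β)) :
    (l.foldr push []).Pairwise fun s t => s.1 = false → t.1 = false := by
  induction l with
  | nil => exact List.Pairwise.nil
  | cons s l ih => exact pairwise_push ih

theorem plusSigns_cons_true (j : β) (l : List (Bool × β)) :
    plusSigns ((true, j) :: l) = (true, j) :: plusSigns l := by
  unfold plusSigns
  rw [List.foldr_cons]
  cases l.foldr push [] <;> simp [push]

/-- In a reduced word every `+` precedes every `-`, so a new leading `-` cancels the first `+`, if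
there is one. -/
theorem plusSigns_cons_false (j : β) (l : List (Bool × β)) :
    plusSigns ((false, j) :: l) = (plusSigns l).tail := by
  unfold plusSigns
  rw [List.foldr_cons]
  have h := pairwise_foldr_push l
  cases hw : l.foldr push [] with
  | nil => simp [push]
  | cons t w =>
    rw [hw] at h
    rcases ht : t.1 with _ | _
    · have hf : w.filter (fun s => s.1) = [] := by
        rw [List.filter_eq_nil_iff]
        intro u hu
        simp [(List.pairwise_cons.1 h).1 u hu ht]
      simp [push, ht, hf]
    · simp [push, ht]

variable {n : ℕ} [NeZero n] {lam : Shape n}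

/-- The signs `+` of the reduced signature of some of the columns. -/
def colPlus (p : Fin n) (b : Filling lam) (L : List (Fin (lam.1.rowLen 0))) :
    List (Bool × Fin (lam.1.rowLen 0)) :=
  plusSigns (L.flatMap (colWord p b))

/-- A column containing both letters has the word `-+`, which cancels itself; hence a column acts
only through `colSign`. -/
theorem colPlus_cons (p : Fin n) (b : Filling lam) (j : Fin (lam.1.rowLen 0))
    (L : List (Fin (lam.1.rowLen 0))) :
    (colSign (crystalRoot p) b j = 1 ∧ colPlus p b (j :: L) = (true, j) :: colPlus p b L) ∨
    (colSign (crystalRoot p) b j = 0 ∧ colPlus p b (j :: L) = colPlus p b L) ∨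
    (colSign (crystalRoot p) b j = -1 ∧ colPlus p b (j :: L) = (colPlus p b L).tail) := by
  unfold colSign colPlus
  rw [List.flatMap_cons, colWord]
  by_cases h1 : ∃ x, b j x = (crystalRoot p).1 <;>
    by_cases h2 : ∃ x, b j x = (crystalRoot p).2 <;>
    simp [h1, h2, plusSigns_cons_true, plusSigns_cons_false]

/-- With `exists_sum_eq_length_colPlus`: the number of remaining `+` is the maximal prefix sum of
the column signs, the empty prefix included. -/
theorem sum_le_length_colPlus (p : Fin n) (b : Filling lam)
    {P L : List (Fin (lam.1.rowLen 0))} (h : P <+: L) :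
    (P.map (colSign (crystalRoot p) b)).sum ≤ (colPlus p b L).length := by
  induction L generalizing P with
  | nil => simp [List.prefix_nil.1 h]
  | cons j L ih =>
    rcases List.prefix_cons_iff.1 h with rfl | ⟨P, rfl, hP⟩
    · simp
    · have := ih hP
      rw [List.map_cons, List.sum_cons]
      rcases colPlus_cons p b j L with ⟨h1, h2⟩ | ⟨h1, h2⟩ | ⟨h1, h2⟩ <;> rw [h1, h2] <;> simp <;>
        omega

theorem exists_sum_eq_length_colPlus (p : Fin n) (b : Filling lam)
    (L : List (Fin (lam.1.rowLen 0))) :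
    ∃ P, P <+: L ∧ (P.map (colSign (crystalRoot p) b)).sum = (colPlus p b L).length := by
  induction L with
  | nil => exact ⟨[], List.prefix_rfl, by simp [colPlus, plusSigns]⟩
  | cons j L ih =>
    obtain ⟨P, hP, h⟩ := ih
    by_cases h0 : (colPlus p b (j :: L)).length = 0
    · exact ⟨[], List.nil_prefix, by simp [h0]⟩
    · refine ⟨j :: P, by simpa using hP, ?_⟩
      rw [List.map_cons, List.sum_cons, h]
      rcases colPlus_cons p b j L with ⟨h1, h2⟩ | ⟨h1, h2⟩ | ⟨h1, h2⟩ <;> rw [h2] at h0 ⊢ <;>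
        rw [h1] <;> simp at h0 ⊢ <;> omega

/-- The hypotheses say that the prefix sums reach their maximum for the first time just after column
`j`. -/
theorem getLast?_colPlus {p : Fin n} {b : Filling lam} {L₁ L₂ : List (Fin (lam.1.rowLen 0))}
    {j : Fin (lam.1.rowLen 0)} (hj : colSign (crystalRoot p) b j = 1)
    (hle : ∀ P, P <+: L₁ ++ j :: L₂ → (P.map (colSign (crystalRoot p) b)).sum ≤
      (L₁.map (colSign (crystalRoot p) b)).sum + 1)
    (hlt : ∀ P, P <+: L₁ → (P.map (colSign (crystalRoot p) b)).sum <
      (L₁.map (colSign (crystalRoot p) b)).sum + 1) :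
    (colPlus p b (L₁ ++ j :: L₂)).getLast? = some (true, j) := by
  induction L₁ with
  | nil =>
    obtain ⟨P, hP, h⟩ := exists_sum_eq_length_colPlus p b (j :: L₂)
    have h' := hle P hP
    rw [List.nil_append]
    rcases colPlus_cons p b j L₂ with ⟨h1, h2⟩ | ⟨h1, h2⟩ | ⟨h1, h2⟩
    · rw [h, h2] at h'
      simp at h'
      simp [h2, h']
    · omega
    · omega
  | cons x L ih =>
    have ih' := ih (fun P hP => by
      have := hle (x :: P) (by simpa using hP)
      simp only [List.map_cons, List.sum_cons] at this
      linarith) (fun P hP => by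
      have := hlt (x :: P) (by simpa using hP)
      simp only [List.map_cons, List.sum_cons] at this
      linarith)
    rw [List.cons_append]
    rcases colPlus_cons p b x (L ++ j :: L₂) with ⟨h1, h2⟩ | ⟨h1, h2⟩ | ⟨h1, h2⟩ <;> rw [h2]
    · rw [List.getLast?_cons, ih']
      rfl
    · exact ih'
    -- The empty prefix forces at least two remaining `+` behind the new `-`, so cancelling the
    -- first does not touch the last.
    · have h3 := hlt [] List.nil_prefix
      have h4 := sum_le_length_colPlus p b (P := L ++ [j]) (L := L ++ j :: L₂)
        (by simp)
      simp only [List.map_cons, List.sum_cons, List.map_nil, List.sum_nil, h1, List.map_append,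
        List.sum_append, hj] at h3 h4
      rw [List.getLast?_tail, if_neg (by omega), ih']

/-- The number of signs `+` in the reduced signature. -/
def plusCount (p : Fin n) (b : Filling lam) : ℕ := (colPlus p b (List.finRange _)).length

theorem sum_take_finRange {N : ℕ} (f : Fin N → ℤ) (t : ℕ) :
    (((List.finRange N).take t).map f).sum =
      ∑ j ∈ Finset.univ.filter fun j : Fin N => j.1 < t, f j := by
  have hnd : ((List.finRange N).take t).Nodup := (List.nodup_finRange N).sublist
    (List.take_sublist _ _)
  rw [← List.sum_toFinset _ hnd]
  congr 1
  ext j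
  simp only [List.mem_toFinset, List.mem_take_iff_getElem, List.getElem_finRange,
    List.length_finRange, Finset.mem_filter, Finset.mem_univ, true_and, Fin.ext_iff]
  constructor
  · rintro ⟨i, hi, h⟩
    simp at h
    omega
  · intro h
    exact ⟨j.1, by omega, rfl⟩

theorem content_le_plusCount (p : Fin n) (b : Filling lam) (t : ℕ) :
    content (crystalRoot p) b t ≤ plusCount p b := by
  unfold content plusCount
  rw [← sum_take_finRange]
  exact sum_le_length_colPlus p b (List.take_prefix _ _)

theorem exists_content_eq_plusCount (p : Fin n) (b : Filling lam) :
    ∃ t ≤ lam.1.rowLen 0, content (crystalRoot p) b t = plusCount p b := by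
  obtain ⟨P, hP, h⟩ := exists_sum_eq_length_colPlus p b (List.finRange _)
  refine ⟨P.length, by simpa using hP.length_le, ?_⟩
  unfold content plusCount
  rw [← h, ← sum_take_finRange, ← List.prefix_iff_eq_take.1 hP]

/-- The letter `α_p.1` of a column is replaced by `α_p.2`. -/
def changeCol (p : Fin n) (b : Filling lam) (j : Fin (lam.1.rowLen 0)) : Filling lam :=
  Function.update b j
    (sortCol fun x => if b j x = (crystalRoot p).1 then (crystalRoot p).2 else b j x)

theorem crystalF_eq_map (p : Fin n) (b : Filling lam) : crystalF p b =
    ((colPlus p b (List.finRange _)).getLast?).map fun s => changeCol p b s.2 := rfl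

theorem crystalF_eq_none_iff {p : Fin n} {b : Filling lam} :
    crystalF p b = none ↔ plusCount p b = 0 := by
  rw [crystalF_eq_map, Option.map_eq_none_iff, List.getLast?_eq_none_iff, plusCount,
    List.length_eq_zero_iff]

/-- `f_p` acts on the first column in which the content attains its maximum. -/
theorem crystalF_eq_some {p : Fin n} {b : Filling lam} {j : Fin (lam.1.rowLen 0)}
    (hle : ∀ t ≤ lam.1.rowLen 0,
      content (crystalRoot p) b t ≤ content (crystalRoot p) b (j.1 + 1))
    (hlt : ∀ t ≤ j.1, content (crystalRoot p) b t < content (crystalRoot p) b (j.1 + 1)) :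
    crystalF p b = some (changeCol p b j) := by
  have hj : colSign (crystalRoot p) b j = 1 := by
    have h1 := hlt j.1 le_rfl
    rw [content_succ] at h1
    unfold colSign at h1 ⊢
    split_ifs at h1 ⊢ <;> omega
  have hsplit : List.finRange (lam.1.rowLen 0) =
      (List.finRange (lam.1.rowLen 0)).take j.1 ++
        j :: (List.finRange (lam.1.rowLen 0)).drop (j.1 + 1) := by
    conv_lhs => rw [← List.take_append_drop j.1 (List.finRange (lam.1.rowLen 0))]
    rw [List.drop_eq_getElem_cons (by simp)]
    simp
  have hS : (((List.finRange (lam.1.rowLen 0)).take j.1).map (colSign (crystalRoot p) b)).sum + 1 =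
      content (crystalRoot p) b (j.1 + 1) := by
    rw [content_succ, hj, sum_take_finRange]
    rfl
  have hcont : ∀ P, P <+: List.finRange (lam.1.rowLen 0) →
      (P.map (colSign (crystalRoot p) b)).sum = content (crystalRoot p) b P.length := by
    intro P hP
    unfold content
    rw [← sum_take_finRange, ← List.prefix_iff_eq_take.1 hP]
  have hlast := getLast?_colPlus (L₁ := (List.finRange (lam.1.rowLen 0)).take j.1)
    (L₂ := (List.finRange (lam.1.rowLen 0)).drop (j.1 + 1)) hj
    (fun P hP => by
      rw [← hsplit] at hP
      rw [hS, hcont P hP]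
      exact hle _ (by simpa using hP.length_le))
    (fun P hP => by
      rw [hS, hcont P (hP.trans (List.take_prefix _ _))]
      refine hlt _ (hP.length_le.trans ?_)
      simp)
  rw [← hsplit] at hlast
  rw [crystalF_eq_map, hlast]
  rfl

theorem exists_sortCol_change {p : Fin n} {b : Filling lam} {j : Fin (lam.1.rowLen 0)} {y : Fin n} :
    (∃ x, changeCol p b j j x = y) ↔
      ∃ x, (if b j x = (crystalRoot p).1 then (crystalRoot p).2 else b j x) = y := by
  unfold changeCol
  rw [Function.update_self]
  exact exists_sortCol

/-- Changing column `j` leaves the content before it alone and lowers it by two afterwards. The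
maximum was first reached just after `j`, so the new maximum is the old value just before `j`, one
less. -/
theorem plusCount_of_crystalF (hn : 2 ≤ n) {p : Fin n} {b c : Filling lam}
    (h : crystalF p b = some c) : plusCount p b = plusCount p c + 1 := by
  have hpos : plusCount p b ≠ 0 := fun h0 => by
    rw [crystalF_eq_none_iff.2 h0] at h
    cases h
  classical
  have hex : ∃ t, t ≤ lam.1.rowLen 0 ∧ content (crystalRoot p) b t = plusCount p b :=
    exists_content_eq_plusCount p b
  obtain ⟨h1, h2⟩ := Nat.find_spec hex
  have h3 := fun t (ht : t < Nat.find hex) => Nat.find_min hex ht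
  have h4 := content_zero (crystalRoot p) b
  obtain ⟨j, hj⟩ : ∃ j, Nat.find hex = j + 1 :=
    Nat.exists_eq_succ_of_ne_zero fun h0 => hpos (by rw [h0, h4] at h2; omega)
  rw [hj] at h1 h2 h3
  obtain ⟨j, rfl⟩ : ∃ j' : Fin (lam.1.rowLen 0), j = j'.1 := ⟨⟨j, h1⟩, rfl⟩
  have hlt : ∀ t ≤ j.1, content (crystalRoot p) b t < content (crystalRoot p) b (j.1 + 1) := by
    intro t ht
    have h5 := content_le_plusCount p b t
    have h6 : content (crystalRoot p) b t ≠ plusCount p b := fun h6 =>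
      h3 t (by omega) ⟨by omega, h6⟩
    omega
  have hc := crystalF_eq_some (fun t _ => by rw [h2]; exact content_le_plusCount p b t) hlt
  rw [h] at hc
  obtain rfl := Option.some.inj hc
  have hne := crystalRoot_ne hn p
  have hj1 : colSign (crystalRoot p) b j = 1 := by
    have h1 := hlt j.1 le_rfl
    rw [content_succ] at h1
    unfold colSign at h1 ⊢
    split_ifs at h1 ⊢ <;> omega
  have hj2 : colSign (crystalRoot p) (changeCol p b j) j = -1 := by
    unfold colSign at hj1 ⊢
    have e1 : ∃ x, b j x = (crystalRoot p).1 := by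
      by_contra h0
      rw [if_neg h0] at hj1
      split_ifs at hj1 <;> omega
    obtain ⟨x, hx⟩ := e1
    rw [if_neg, if_pos]
    · rfl
    · exact exists_sortCol_change.2 ⟨x, if_pos hx⟩
    · rw [exists_sortCol_change]
      rintro ⟨y, hy⟩
      split_ifs at hy with h0
      · exact hne hy.symm
      · exact h0 hy
  have hjo : ∀ i, i ≠ j →
      colSign (crystalRoot p) (changeCol p b j) i = colSign (crystalRoot p) b i := by
    intro i hi
    unfold colSign changeCol
    rw [Function.update_of_ne hi]
  have hcl : ∀ t ≤ j.1, content (crystalRoot p) (changeCol p b j) t = content (crystalRoot p) b t := by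
    intro t ht
    refine Finset.sum_congr rfl fun i hi => hjo i ?_
    rintro rfl
    simp at hi
    omega
  have hcr : ∀ t, j.1 < t →
      content (crystalRoot p) (changeCol p b j) t = content (crystalRoot p) b t - 2 := by
    intro t ht
    have hmem : j ∈ Finset.univ.filter fun i : Fin (lam.1.rowLen 0) => i.1 < t := by simpa using ht
    unfold content
    rw [← Finset.add_sum_erase _ _ hmem, ← Finset.add_sum_erase _ _ hmem, hj1, hj2,
      Finset.sum_congr rfl fun i hi => hjo i (Finset.ne_of_mem_erase hi)]
    ring
  obtain ⟨t, -, ht⟩ := exists_content_eq_plusCount p (changeCol p b j)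
  have h7 := content_le_plusCount p (changeCol p b j) j.1
  have h8 := content_le_plusCount p b t
  rw [hcl j.1 le_rfl] at h7
  rw [content_succ, hj1] at h2
  rcases le_or_gt t j.1 with h9 | h9
  · have := hlt t h9
    rw [content_succ, hj1] at this
    have := hcl t h9
    omega
  · have := hcr t h9
    omega

theorem iterate_crystalF_ne_none (hn : 2 ≤ n) (p : Fin n) (b : Filling lam) (k : ℕ) :
    (fun x : Option (Filling lam) => x.bind (crystalF p))^[k] (some b) ≠ none ↔
      k ≤ plusCount p b := by
  induction k generalizing b with
  | zero => simp
  | succ k ih =>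
    rw [Function.iterate_succ_apply, Option.bind_some]
    cases h : crystalF p b with
    | none =>
      rw [Function.iterate_fixed rfl, crystalF_eq_none_iff.1 h]
      simp
    | some c =>
      rw [ih, plusCount_of_crystalF hn h]
      omega

theorem phi_eq_plusCount (hn : 2 ≤ n) (p : Fin n) (b : Filling lam) : phi p b = plusCount p b := by
  unfold phi
  simp only [iterate_crystalF_ne_none hn]
  exact csSup_Iic

theorem dualDemazure_iff (hn : 2 ≤ n) {p : Fin n} {b : Filling lam} :
    DualDemazure p b ↔ (if p = 0 then 1 else 0) < plusCount p b := by
  unfold DualDemazure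
  rw [phi_eq_plusCount hn, Ne, crystalF_eq_none_iff]
  split_ifs with hp
  · simp only [hp, ne_eq, not_true, false_or]
    omega
  · simp only [ne_eq, hp, not_false_eq_true, true_or, and_true]
    omega

end Reduction

/-! ### Maxima of `g_α` -/

section Maximum

variable {n : ℕ} [NeZero n] {lam : Shape n} {J : Finset (Pos lam)} {p : Fin n}

/-- The positive orientation persists until the next visit. -/
theorem Admissible.orient_eq_one (hJ : Admissible J) {t t' : ℕ} (h1 : t ≤ t')
    (h2 : t' ≤ (chain lam).length) (ht : orient (permAt J t) (crystalRoot p) = 1)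
    (h : ∀ i ∈ iSet J (crystalRoot p), t ≤ i.1 → t' ≤ i.1) :
    orient (permAt J t') (crystalRoot p) = 1 := by
  refine time_induction (P := fun t => orient (permAt J t) (crystalRoot p) = 1) h2 ht ?_ h1 le_rfl
  intro i h3 h4 ih
  refine (orient_cases _ _).resolve_right fun h5 => ?_
  have := h i (hJ.mem_of_orient ih h5).1 h3
  omega

theorem Admissible.exists_visit_of_orient (hJ : Admissible J) {t : ℕ} {k : Pos lam}
    (hk : k ∈ iSet J (crystalRoot p)) (htk : t ≤ k.1)
    (ht : orient (permAt J t) (crystalRoot p) = 1) :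
    ∃ i ∈ iSet J (crystalRoot p), i ≤ k ∧ height J (crystalRoot p) i.1 +
      orient (permAt J i.1) (crystalRoot p) = height J (crystalRoot p) t + 1 := by
  have hne : ((iSet J (crystalRoot p)).filter fun i => t ≤ i.1).Nonempty :=
    ⟨k, Finset.mem_filter.2 ⟨hk, htk⟩⟩
  have hmem := Finset.min'_mem _ hne
  have hmin : ∀ i ∈ iSet J (crystalRoot p), t ≤ i.1 → (Finset.min' _ hne).1 ≤ i.1 :=
    fun i hi hti => Finset.min'_le _ i (Finset.mem_filter.2 ⟨hi, hti⟩)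
  generalize Finset.min' _ hne = i at hmem hmin
  rw [Finset.mem_filter] at hmem
  refine ⟨i, hmem.1, hmin k hk htk, ?_⟩
  rw [height_eq_of_forall_notMem hmem.2 hmin, hJ.orient_eq_one hmem.2 i.2.le ht hmin]

/-- Negative orientation can only come from the last visit, whose second half then descended from
its midpoint, or from the very beginning, where only the negative root `α_0` has it. -/
theorem Admissible.exists_visit_of_orient_neg (hJ : Admissible J) {t : ℕ}
    (h : t ≤ (chain lam).length) (ht : orient (permAt J t) (crystalRoot p) = -1) :
    (∃ i ∈ iSet J (crystalRoot p), i.1 < t ∧ height J (crystalRoot p) i.1 +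
      orient (permAt J i.1) (crystalRoot p) = height J (crystalRoot p) t + 1) ∨
    (height J (crystalRoot p) t = 1 ∧ p = 0) := by
  revert ht
  refine time_induction (P := fun t => orient (permAt J t) (crystalRoot p) = -1 → (∃ i ∈
    iSet J (crystalRoot p), i.1 < t ∧ height J (crystalRoot p) i.1 +
      orient (permAt J i.1) (crystalRoot p) = height J (crystalRoot p) t + 1) ∨
    (height J (crystalRoot p) t = 1 ∧ p = 0)) le_rfl ?_ ?_ (Nat.zero_le t) h
  · intro ht
    rw [permAt_zero] at ht
    refine Or.inr ⟨by rw [height_zero, ht]; rfl, ?_⟩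
    rw [orient_one, sgn_crystalRoot] at ht
    by_contra hp
    rw [if_neg hp] at ht
    omega
  · rintro i - - ih ht
    by_cases hi : i ∈ iSet J (crystalRoot p)
    · refine Or.inl ⟨i, hi, Nat.lt_succ_self _, ?_⟩
      rw [height_succ_of_mem hi, ht]
      ring
    · rw [height_succ_of_notMem hi]
      rcases ih ((orient_cases _ _).resolve_left fun h1 => hi (hJ.mem_of_orient h1 ht).1) with
        ⟨i', h1, h2, h3⟩ | h1
      · exact Or.inl ⟨i', h1, by omega, h3⟩
      · exact Or.inr h1

theorem graphValue_of_mem {i : Pos lam} (hi : i ∈ iSet J (crystalRoot p)) :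
    GraphValue J (crystalRoot p)
      (height J (crystalRoot p) i.1 + orient (permAt J i.1) (crystalRoot p)) :=
  Or.inl (Or.inr ⟨i, hi, i.2, rfl⟩)

/-- Only the initial point of `g_{α_0}` can be a local maximum outside the heights `l_i^Δ`. -/
theorem Admissible.graphValue_height_add_one (hJ : Admissible J) {t : ℕ}
    (h : t ≤ (chain lam).length) : GraphValue J (crystalRoot p) (height J (crystalRoot p) t + 1) ∨
      (height J (crystalRoot p) t = 1 ∧ p = 0) := by
  rcases orient_cases (permAt J t) (crystalRoot p) with ht | ht
  · left
    by_cases hk : ∃ k ∈ iSet J (crystalRoot p), t ≤ k.1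
    · obtain ⟨k, hk, htk⟩ := hk
      obtain ⟨i, hi, -, h1⟩ := hJ.exists_visit_of_orient hk htk ht
      exact h1 ▸ graphValue_of_mem hi
    · have hno : ∀ i ∈ iSet J (crystalRoot p), t ≤ i.1 → (chain lam).length ≤ i.1 :=
        fun i hi hti => absurd ⟨i, hi, hti⟩ hk
      right
      rw [height_eq_of_forall_notMem h hno, hJ.orient_eq_one h le_rfl ht hno]
  · rcases hJ.exists_visit_of_orient_neg h ht with ⟨i, hi, -, h1⟩ | h1
    · exact Or.inl (h1 ▸ graphValue_of_mem hi)
    · exact Or.inr h1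

theorem mem_maxSet_coe (hn : 2 ≤ n) {z : ℤ} (hz : 2 * graphMax J (crystalRoot p) = z)
    {i : Pos lam} : WithTop.some i ∈ maxSet J (crystalRoot p) ↔ i ∈ iSet J (crystalRoot p) ∧
      height J (crystalRoot p) i.1 + orient (permAt J i.1) (crystalRoot p) = z := by
  have hα := crystalRoot_ne hn p
  have h1 : WithTop.some i ∈ iHat J (crystalRoot p) ↔ i ∈ iSet J (crystalRoot p) := by
    simp [iHat]
  rw [maxSet, Finset.mem_filter, h1]
  refine and_congr_right fun hi => ?_
  rw [sgn_mul_hatLvl_coe hα hi, height_of_mem hα hi, ← @Int.cast_inj ℚ, ← hz]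
  push_cast
  constructor <;> intro h <;> linarith

theorem mem_maxSet_top (hn : 2 ≤ n) {z : ℤ} (hz : 2 * graphMax J (crystalRoot p) = z) :
    ⊤ ∈ maxSet J (crystalRoot p) ↔ height J (crystalRoot p) (chain lam).length +
      orient (permAt J (chain lam).length) (crystalRoot p) = z := by
  have hα := crystalRoot_ne hn p
  have h1 : ⊤ ∈ iHat J (crystalRoot p) := by simp [iHat]
  have h2 := height_blockTime (J := J) hα (le_refl (lam.1.rowLen 0))
  rw [blockTime_last le_rfl] at h2
  rw [maxSet, Finset.mem_filter, h2, sgn_mul_hatLvl_top, ← @Int.cast_inj ℚ, ← hz]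
  push_cast
  constructor
  · rintro ⟨-, h⟩
    linarith
  · intro h
    exact ⟨h1, by linarith⟩

/-- A value between two visits is never the maximum, because one more than its double is attained
too; the starting height of `g_{α_0}` is ruled out by the threshold. -/
theorem Admissible.maxSet_nonempty (hJ : Admissible J) (hn : 2 ≤ n) {z : ℤ}
    (hz : 2 * graphMax J (crystalRoot p) = z) (hv : GraphValue J (crystalRoot p) z)
    (hmax : ∀ v, GraphValue J (crystalRoot p) v → v ≤ z) (hlt : (if p = 0 then 2 else 0) < z) :
    (maxSet J (crystalRoot p)).Nonempty := by
  rcases hv with (⟨t, ht, rfl⟩ | ⟨i, hi, -, h⟩) | h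
  · exfalso
    rcases hJ.graphValue_height_add_one (p := p) ht with h | ⟨h1, h2⟩
    · have := hmax _ h
      omega
    · rw [if_pos h2] at hlt
      omega
  · exact ⟨_, (mem_maxSet_coe hn hz).2 ⟨hi, h.symm⟩⟩
  · exact ⟨_, (mem_maxSet_top hn hz).2 h.symm⟩

end Maximum

/-! ### The effect of `f_p` on the filling -/

section Operator

variable {n : ℕ} {lam : Shape n}

theorem refl_mul_permAt {J : Finset (Pos lam)} {α : Fin n × Fin n} {i : Pos lam}
    (hi : i ∈ iSet J α) : permAt J i.1 * refl (beta i) = refl α * permAt J i.1 := by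
  have h : refl (act (permAt J i.1) (beta i)) = refl α := by
    rw [← gam_eq]
    simp only [iSet, Finset.mem_filter, Finset.mem_univ, true_and] at hi
    rcases hi with h | h <;> rw [h]
    exact Equiv.swap_comm _ _
  rw [← h]
  exact Equiv.mul_swap_eq_swap_mul _ _ _

theorem permAt_congr {J J' : Finset (Pos lam)} {t : ℕ} (h : ∀ i : Pos lam, i.1 < t →
    (i ∈ J' ↔ i ∈ J)) : permAt J' t = permAt J t := by
  unfold permAt
  congr 1
  ext i
  simp only [cut, Finset.mem_filter]
  exact and_congr_left fun hi => h i hi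

/-- Since `γ_k = ±α`, the factor inserted at `k` can be moved to the far left as `s_α`, and later
folds multiply on the right. -/
theorem permAt_of_fold {J J' : Finset (Pos lam)} {α : Fin n × Fin n} {k : Pos lam} {e : ℕ}
    (he : e ≤ (chain lam).length) (hk : k ∈ iSet J α) (hkJ : k ∉ J) (hkJ' : k ∈ J')
    (h : ∀ i : Pos lam, i.1 < e → i ≠ k → (i ∈ J' ↔ i ∈ J)) {t : ℕ} (h1 : k.1 < t) (h2 : t ≤ e) :
    permAt J' t = refl α * permAt J t := by
  refine time_induction (P := fun t => permAt J' t = refl α * permAt J t) he ?_ ?_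
    (Nat.succ_le_of_lt h1) h2
  · rw [Nat.succ_eq_add_one, permAt_succ_of_mem hkJ', permAt_succ_of_notMem hkJ,
      permAt_congr (J := J) (J' := J'), refl_mul_permAt hk]
    exact fun i hi => h i (by omega) (by rintro rfl; omega)
  · intro i h3 h4 ih
    have hiff := h i h4 (by rintro rfl; omega)
    by_cases hi : i ∈ J
    · rw [permAt_succ_of_mem hi, permAt_succ_of_mem (hiff.2 hi), ih, mul_assoc]
    · rw [permAt_succ_of_notMem hi, permAt_succ_of_notMem fun h' => hi (hiff.1 h'), ih]

theorem permAt_of_unfold {J J' : Finset (Pos lam)} {α : Fin n × Fin n} {m : Pos lam}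
    (hm : m ∈ iSet J α) (hmJ : m ∈ J) (hmJ' : m ∉ J')
    (hperm : permAt J' m.1 = refl α * permAt J m.1)
    (h : ∀ i : Pos lam, m < i → (i ∈ J' ↔ i ∈ J)) {t : ℕ} (h1 : m.1 < t)
    (h2 : t ≤ (chain lam).length) : permAt J' t = permAt J t := by
  refine time_induction (P := fun t => permAt J' t = permAt J t) le_rfl ?_ ?_
    (Nat.succ_le_of_lt h1) h2
  · rw [Nat.succ_eq_add_one, permAt_succ_of_mem hmJ, permAt_succ_of_notMem hmJ', hperm,
      refl_mul_permAt hm]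
  · intro i h3 _ ih
    have hiff := h i h3
    by_cases hi : i ∈ J
    · rw [permAt_succ_of_mem hi, permAt_succ_of_mem (hiff.2 hi), ih]
    · rw [permAt_succ_of_notMem hi, permAt_succ_of_notMem fun h' => hi (hiff.1 h'), ih]

theorem column_ext {r : ℕ} {f g : Fin r → Fin n} (hf : StrictMono f) (hg : StrictMono g)
    (h : ∀ y, (∃ x, f x = y) ↔ ∃ x, g x = y) : f = g :=
  (hf.range_inj hg).1 (Set.ext h)

theorem sfill_eq_of_permAt {J J' : Finset (Pos lam)} {j : Fin (lam.1.rowLen 0)}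
    (h : permAt J' (blockTime lam (j.1 + 1)) = permAt J (blockTime lam (j.1 + 1))) :
    sfill J' j = sfill J j :=
  column_ext (sfill_mem J' j) (sfill_mem J j) fun y => by rw [exists_sfill, exists_sfill, h]

theorem exists_sfill_of_refl {J J' : Finset (Pos lam)} {α : Fin n × Fin n}
    {j : Fin (lam.1.rowLen 0)}
    (h : permAt J' (blockTime lam (j.1 + 1)) = refl α * permAt J (blockTime lam (j.1 + 1)))
    (y : Fin n) : (∃ x, sfill J' j x = y) ↔ ∃ x, sfill J j x = refl α y := by
  rw [exists_sfill, exists_sfill, h, mul_inv_rev, Equiv.Perm.mul_apply]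
  have : (refl α)⁻¹ = refl α := by simp [refl]
  rw [this]

/-- A column with both letters or neither has a set of entries stable under `s_α`, and a sorted
column is determined by that set. -/
theorem sfill_eq_of_colSign {J J' : Finset (Pos lam)} {α : Fin n × Fin n}
    {j : Fin (lam.1.rowLen 0)}
    (h : permAt J' (blockTime lam (j.1 + 1)) = refl α * permAt J (blockTime lam (j.1 + 1)))
    (hs : colSign α (sfill J) j = 0) : sfill J' j = sfill J j := by
  refine column_ext (sfill_mem J' j) (sfill_mem J j) fun y => ?_
  rw [exists_sfill_of_refl h]
  have hiff : (∃ x, sfill J j x = α.1) ↔ ∃ x, sfill J j x = α.2 := by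
    unfold colSign at hs
    split_ifs at hs with h1 h2 h2
    · exact iff_of_true h1 h2
    · omega
    · omega
    · exact iff_of_false h1 h2
  simp only [refl, Equiv.swap_apply_def]
  split_ifs with h1 h2
  · rw [h1, hiff]
  · rw [h2, hiff]
  · rfl

theorem sfill_eq_changeCol [NeZero n] (hn : 2 ≤ n) {J J' : Finset (Pos lam)} {p : Fin n}
    {j : Fin (lam.1.rowLen 0)} (h : permAt J' (blockTime lam (j.1 + 1)) =
      refl (crystalRoot p) * permAt J (blockTime lam (j.1 + 1)))
    (hs : colSign (crystalRoot p) (sfill J) j = 1)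
    (hc : changeCol p (sfill J) j ∈ KRTensor lam) : sfill J' j = changeCol p (sfill J) j j := by
  have hne := crystalRoot_ne hn p
  refine column_ext (sfill_mem J' j) (hc j) fun y => ?_
  rw [exists_sfill_of_refl h, exists_sortCol_change]
  have h12 : (∃ x, sfill J j x = (crystalRoot p).1) ∧ ¬ ∃ x, sfill J j x = (crystalRoot p).2 := by
    unfold colSign at hs
    split_ifs at hs with h1 h2 h2
    · omega
    · exact ⟨h1, h2⟩
    · omega
    · omega
  obtain ⟨⟨x₀, hx₀⟩, hno⟩ := h12
  simp only [refl, Equiv.swap_apply_def]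
  split_ifs with h1 h2
  · subst h1
    refine iff_of_false hno ?_
    rintro ⟨x, hx⟩
    split_ifs at hx with h3
    · exact hne hx.symm
    · exact h3 hx
  · subst h2
    exact iff_of_true ⟨x₀, hx₀⟩ ⟨x₀, if_pos hx₀⟩
  · refine exists_congr fun x => ?_
    split_ifs with h3
    · rw [h3]
      exact iff_of_false (fun h4 => h1 h4.symm) (fun h4 => h2 h4.symm)
    · rfl

end Operator

/-! ### The crystal operators on admissible subsets and on fillings -/

section Main

variable {n : ℕ} [NeZero n] {lam : Shape n} {J : Finset (Pos lam)} {p : Fin n}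

theorem Admissible.height_lt (hJ : Admissible J) {z : ℤ}
    (hmax : ∀ v, GraphValue J (crystalRoot p) v → v ≤ z) (hlt : (if p = 0 then 2 else 0) < z)
    {t : ℕ} (ht : t ≤ (chain lam).length) : height J (crystalRoot p) t < z := by
  rcases hJ.graphValue_height_add_one (p := p) ht with h | ⟨h1, h2⟩
  · have := hmax _ h
    omega
  · rw [if_pos h2] at hlt
    omega

/-- The first time `e` at which the maximum of `g_{α_p}` is attained, and the last visit before. -/
structure IsFirstMax (J : Finset (Pos lam)) (p : Fin n) (z : ℤ) (e : ℕ) (k : Pos lam) :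
    Prop where
  le_length : e ≤ (chain lam).length
  mem : k ∈ iSet J (crystalRoot p)
  lt : k.1 < e
  le_of_mem : ∀ i ∈ iSet J (crystalRoot p), i.1 < e → i ≤ k
  ne_of_lt : ∀ i ∈ iSet J (crystalRoot p), i.1 < e →
    height J (crystalRoot p) i.1 + orient (permAt J i.1) (crystalRoot p) ≠ z
  orient_end : orient (permAt J e) (crystalRoot p) = 1
  height_end : height J (crystalRoot p) e = z - 1
  notMem : k ∉ J
  orient_eq : orient (permAt J k.1) (crystalRoot p) = 1

theorem Admissible.exists_isFirstMax (hJ : Admissible J) {z : ℤ}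
    (hmax : ∀ v, GraphValue J (crystalRoot p) v → v ≤ z) (hlt : (if p = 0 then 2 else 0) < z)
    {e : ℕ} (he : e ≤ (chain lam).length)
    (hez : height J (crystalRoot p) e + orient (permAt J e) (crystalRoot p) = z)
    (hmin : ∀ i ∈ iSet J (crystalRoot p), i.1 < e →
      height J (crystalRoot p) i.1 + orient (permAt J i.1) (crystalRoot p) ≠ z) :
    ∃ k, IsFirstMax J p z e k := by
  have hb := hJ.height_lt hmax hlt he
  have hs : orient (permAt J e) (crystalRoot p) = 1 :=
    (orient_cases _ _).resolve_right fun h => by omega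
  -- Without an earlier visit the height would still be its starting value, too low for `z` to
  -- exceed the threshold.
  have hne : ((iSet J (crystalRoot p)).filter fun i => i.1 < e).Nonempty := by
    rw [Finset.nonempty_iff_ne_empty]
    intro h0
    have h1 := height_eq_of_forall_notMem (J := J) (α := crystalRoot p) (Nat.zero_le e)
      fun i hi _ => not_lt.1 fun h => Finset.notMem_empty i (h0 ▸ Finset.mem_filter.2 ⟨hi, h⟩)
    rw [height_zero, orient_one, sgn_crystalRoot] at h1
    split_ifs at h1 hlt <;> omega
  have hmem := Finset.max'_mem _ hne
  have hle : ∀ i ∈ iSet J (crystalRoot p), i.1 < e → i ≤ Finset.max' _ hne :=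
    fun i hi hie => Finset.le_max' _ i (Finset.mem_filter.2 ⟨hi, hie⟩)
  generalize Finset.max' _ hne = k at hmem hle
  rw [Finset.mem_filter] at hmem
  obtain ⟨hk, hke⟩ := hmem
  have hh : height J (crystalRoot p) e = height J (crystalRoot p) (k.1 + 1) :=
    height_eq_of_forall_notMem hke fun i hi hki => not_lt.1 fun hie => by
      have := hle i hi hie
      rw [Fin.le_def] at this
      omega
  have hsucc := height_succ_of_mem hk
  have hkz := hmin k hk hke
  have h2 : orient (permAt J (k.1 + 1)) (crystalRoot p) = 1 :=
    (orient_cases _ _).resolve_right fun h => hkz (by omega)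
  -- With negative orientation at `k`, the height there would be `z - 1`, so an earlier visit would
  -- already reach `z`.
  have h1 : orient (permAt J k.1) (crystalRoot p) = 1 := by
    refine (orient_cases _ _).resolve_right fun h => ?_
    rcases hJ.exists_visit_of_orient_neg k.2.le h with ⟨i, hi, hik, h3⟩ | ⟨h3, h4⟩
    · exact hmin i hi (hik.trans hke) (by omega)
    · rw [if_pos h4] at hlt
      omega
  refine ⟨k, he, hk, hke, hle, hmin, hs, by omega, fun hkJ => ?_, h1⟩
  rw [orient_succ_of_mem hk hkJ, h1] at h2
  omega

variable {z : ℤ} {e : ℕ} {k : Pos lam}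

theorem Admissible.content_le (hJ : Admissible J) (hn : 2 ≤ n)
    (hmax : ∀ v, GraphValue J (crystalRoot p) v → v ≤ z) (hlt : (if p = 0 then 2 else 0) < z)
    {t : ℕ} (ht : t ≤ lam.1.rowLen 0) :
    2 * content (crystalRoot p) (sfill J) t ≤ z := by
  have h1 := height_blockTime (J := J) (crystalRoot_ne hn p) ht
  have h2 := hJ.height_lt hmax hlt (blockTime_le (lam := lam) t)
  rcases orient_cases (permAt J (blockTime lam t)) (crystalRoot p) with h | h <;> omega

/-- With positive orientation, twice the content is the value at the next visit, which is at most
`k` and misses the maximum. With negative orientation it lies below the height. -/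
theorem IsFirstMax.content_lt (hf : IsFirstMax J p z e k) (hJ : Admissible J) (hn : 2 ≤ n)
    (hmax : ∀ v, GraphValue J (crystalRoot p) v → v ≤ z) (hlt : (if p = 0 then 2 else 0) < z)
    {t : ℕ} (ht : t ≤ (block k).1) :
    2 * content (crystalRoot p) (sfill J) t < z := by
  have hk : blockTime lam t ≤ k.1 := (blockTime_mono ht).trans (blockTime_block_le k)
  have h1 := height_blockTime (J := J) (crystalRoot_ne hn p) (ht.trans (block k).2.le)
  have h2 := hJ.height_lt hmax hlt (blockTime_le (lam := lam) t)
  rcases orient_cases (permAt J (blockTime lam t)) (crystalRoot p) with h | h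
  · obtain ⟨i, hi, hik, h3⟩ := hJ.exists_visit_of_orient hf.mem hk h
    have h4 := hf.ne_of_lt i hi (lt_of_le_of_lt (Fin.le_def.1 hik) hf.lt)
    have h5 := hmax _ (graphValue_of_mem hi)
    omega
  · omega

/-- Between `k` and `e` there is no visit, so the orientation stays `1` and the height stays `z -
1`. -/
theorem IsFirstMax.content_eq (hf : IsFirstMax J p z e k) (hJ : Admissible J) (hn : 2 ≤ n)
    {t : ℕ} (ht : t ≤ lam.1.rowLen 0) (hkt : k.1 < blockTime lam t) (hte : blockTime lam t ≤ e) :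
    2 * content (crystalRoot p) (sfill J) t = z := by
  have hno : ∀ i ∈ iSet J (crystalRoot p), k.1 + 1 ≤ i.1 → e ≤ i.1 := fun i hi hki =>
    not_lt.1 fun hie => by
      have := hf.le_of_mem i hi hie
      rw [Fin.le_def] at this
      omega
  have hs : orient (permAt J (blockTime lam t)) (crystalRoot p) = 1 :=
    hJ.orient_eq_one (Nat.succ_le_of_lt hkt) (blockTime_le t)
      (by rw [Nat.succ_eq_add_one, permAt_succ_of_notMem hf.notMem, hf.orient_eq])
      fun i hi hki => hte.trans (hno i hi hki)
  have hh := height_eq_of_forall_notMem hte fun i hi hti => hno i hi (by omega)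
  have h1 := height_blockTime (J := J) (crystalRoot_ne hn p) ht
  have h2 := hf.height_end
  omega

theorem IsFirstMax.crystalF_eq (hf : IsFirstMax J p z e k) (hJ : Admissible J) (hn : 2 ≤ n)
    (hmax : ∀ v, GraphValue J (crystalRoot p) v → v ≤ z) (hlt : (if p = 0 then 2 else 0) < z)
    (hbe : blockTime lam ((block k).1 + 1) ≤ e) {J' : Finset (Pos lam)}
    (h1 : ∀ t ≤ k.1, permAt J' t = permAt J t)
    (h2 : ∀ t, k.1 < t → t ≤ e → permAt J' t = refl (crystalRoot p) * permAt J t)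
    (h3 : ∀ t, e < t → t ≤ (chain lam).length → permAt J' t = permAt J t) :
    crystalF p (sfill J) = some (sfill J') := by
  have hb1 := hf.content_eq hJ hn (block k).2 (lt_blockTime_block k) hbe
  rw [Nat.succ_eq_add_one] at hb1
  have hle : ∀ t ≤ lam.1.rowLen 0, content (crystalRoot p) (sfill J) t ≤
      content (crystalRoot p) (sfill J) ((block k).1 + 1) := fun t ht => by
    have := hJ.content_le hn hmax hlt ht
    omega
  have hlt' : ∀ t ≤ (block k).1, content (crystalRoot p) (sfill J) t <
      content (crystalRoot p) (sfill J) ((block k).1 + 1) := fun t ht => by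
    have := hf.content_lt hJ hn hmax hlt ht
    omega
  have hc := crystalF_eq_some hle hlt'
  have hmem := crystalF_mem (sfill_mem J) hc
  rw [hc]
  congr 1
  funext j
  by_cases hj : j = block k
  · subst hj
    refine (sfill_eq_changeCol hn (h2 _ (lt_blockTime_block k) hbe) ?_ hmem).symm
    have h4 := hlt' _ le_rfl
    rw [content_succ] at h4
    unfold colSign at h4 ⊢
    split_ifs at h4 ⊢ <;> omega
  · have hch : changeCol p (sfill J) (block k) j = sfill J j := Function.update_of_ne hj _ _
    rw [hch]
    symm
    rcases lt_or_gt_of_ne hj with hj | hj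
    · exact sfill_eq_of_permAt (h1 _ ((blockTime_mono (Fin.lt_def.1 hj)).trans
        (blockTime_block_le k)))
    · have hkj : k.1 < blockTime lam j.1 := lt_blockTime.2 hj
      have hjj : blockTime lam j.1 ≤ blockTime lam (j.1 + 1) := blockTime_mono (Nat.le_succ _)
      by_cases hje : blockTime lam (j.1 + 1) ≤ e
      · refine sfill_eq_of_colSign (h2 _ (hkj.trans_le hjj) hje) ?_
        -- The content is the same before and after this column, so its sign is zero.
        have h4 := hf.content_eq hJ hn j.2.le hkj (hjj.trans hje)
        have h5 := hf.content_eq hJ hn j.2 (hkj.trans_le hjj) hje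
        rw [Nat.succ_eq_add_one, content_succ] at h5
        omega
      · exact sfill_eq_of_permAt (h3 _ (not_le.1 hje) (blockTime_le _))

theorem max'_eq_of_isFirstMax (hf : IsFirstMax J p z e k) {S : Finset (Pos lam)}
    (hS : ∀ i, i ∈ S ↔ i ∈ iSet J (crystalRoot p) ∧ i.1 < e) (hne : S.Nonempty) :
    S.max' hne = k := by
  refine le_antisymm (Finset.max'_le _ _ _ fun i hi => ?_)
    (Finset.le_max' _ _ ((hS k).2 ⟨hf.mem, hf.lt⟩))
  exact hf.le_of_mem i ((hS i).1 hi).1 ((hS i).1 hi).2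

theorem Admissible.alcoveF_eq_some (hJ : Admissible J) (hn : 2 ≤ n)
    (hz : 2 * graphMax J (crystalRoot p) = z) (hv : GraphValue J (crystalRoot p) z)
    (hmax : ∀ v, GraphValue J (crystalRoot p) v → v ≤ z) (hlt : (if p = 0 then 2 else 0) < z) :
    ∃ J', alcoveF p J = some J' ∧ crystalF p (sfill J) = some (sfill J') := by
  have hM : (if p = 0 then 1 else 0 : ℚ) < graphMax J (crystalRoot p) := by
    have h : (((if p = 0 then 2 else 0 : ℤ)) : ℚ) < z := by exact_mod_cast hlt
    rw [← hz] at h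
    split_ifs at h ⊢ <;> push_cast at h <;> linarith
  have hm := hJ.maxSet_nonempty hn hz hv hmax hlt
  have hmem := Finset.min'_mem _ hm
  have hmin : ∀ i, WithTop.some i ∈ maxSet J (crystalRoot p) →
      (maxSet J (crystalRoot p)).min' hm ≤ WithTop.some i := fun i hi => Finset.min'_le _ _ hi
  unfold alcoveF
  rw [if_pos hM, dif_pos hm]
  dsimp only
  generalize (maxSet J (crystalRoot p)).min' hm = m at hmem hmin
  induction m using WithTop.recTopCoe with
  | top =>
    have hez := (mem_maxSet_top hn hz).1 hmem
    obtain ⟨k, hf⟩ := hJ.exists_isFirstMax hmax hlt le_rfl hez fun i hi hie h =>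
      (hmin i ((mem_maxSet_coe hn hz).2 ⟨hi, h⟩)).not_gt (WithTop.coe_lt_top i)
    have hS : ∀ i, (i ∈ (iSet J (crystalRoot p)).filter fun i => WithTop.some i < ⊤) ↔
        i ∈ iSet J (crystalRoot p) ∧ i.1 < (chain lam).length := by
      intro i
      rw [Finset.mem_filter]
      exact and_congr_right fun _ => iff_of_true (WithTop.coe_lt_top i) i.2
    have hne : ((iSet J (crystalRoot p)).filter fun i => WithTop.some i < ⊤).Nonempty :=
      ⟨k, (hS k).2 ⟨hf.mem, hf.lt⟩⟩
    rw [dif_pos hne, max'_eq_of_isFirstMax hf hS hne]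
    refine ⟨_, rfl, ?_⟩
    have hJ' : ∀ i, i ∈ (J.filter fun j => WithTop.some j ≠ ⊤) ∪ {k} ↔ i ∈ J ∨ i = k := by
      simp [or_comm]
    refine hf.crystalF_eq hJ hn hmax hlt (blockTime_le _) (fun t ht => permAt_congr fun i hi => ?_)
      (fun t h1 h2 => permAt_of_fold le_rfl hf.mem hf.notMem ((hJ' k).2 (Or.inr rfl))
        (fun i _ hik => ?_) h1 h2) (fun t h1 h2 => absurd h1 h2.not_gt)
    · rw [hJ', or_iff_left]
      rintro rfl
      omega
    · rw [hJ', or_iff_left hik]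
  | coe m =>
    obtain ⟨hmI, hez⟩ := (mem_maxSet_coe hn hz).1 hmem
    obtain ⟨k, hf⟩ := hJ.exists_isFirstMax hmax hlt m.2.le hez fun i hi hie h =>
      (WithTop.coe_le_coe.1 (hmin i ((mem_maxSet_coe hn hz).2 ⟨hi, h⟩))).not_gt hie
    have hS : ∀ i, (i ∈ (iSet J (crystalRoot p)).filter fun i => WithTop.some i < (m : WithTop _)) ↔
        i ∈ iSet J (crystalRoot p) ∧ i.1 < m.1 := by
      intro i
      rw [Finset.mem_filter]
      exact and_congr_right fun _ => WithTop.coe_lt_coe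
    have hne : ((iSet J (crystalRoot p)).filter
        fun i => WithTop.some i < (m : WithTop (Pos lam))).Nonempty :=
      ⟨k, (hS k).2 ⟨hf.mem, hf.lt⟩⟩
    rw [dif_pos hne, max'_eq_of_isFirstMax hf hS hne]
    refine ⟨_, rfl, ?_⟩
    have hkm : k < m := hf.lt
    have hJ' : ∀ i, i ∈ (J.filter fun j => WithTop.some j ≠ (m : WithTop _)) ∪ {k} ↔
        (i ∈ J ∧ i ≠ m) ∨ i = k := by
      intro i
      rw [Finset.mem_union, Finset.mem_filter, Finset.mem_singleton, Ne, WithTop.coe_inj]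
    -- An unfolded visit at `m` would continue upwards to height `z + 1`.
    have hmJ : m ∈ J := by
      by_contra hmJ
      have h1 := height_succ_of_mem hmI
      rw [orient_succ_of_notMem hmJ, hf.orient_end, hf.height_end] at h1
      have h2 := hJ.height_lt hmax hlt m.2
      rw [Nat.succ_eq_add_one] at h2
      omega
    -- The column of `k` must be completed before the fold at `m` is undone; otherwise the two
    -- changes would cancel without affecting the filling.
    have hbe : blockTime lam ((block k).1 + 1) ≤ m.1 :=
      (blockTime_mono (Fin.lt_def.1 (hJ.block_lt hf.mem hmI hf.notMem hf.orient_eq hkm))).trans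
        (blockTime_block_le m)
    have hfold : ∀ t, k.1 < t → t ≤ m.1 → permAt ((J.filter fun j => WithTop.some j ≠
        (m : WithTop _)) ∪ {k}) t = refl (crystalRoot p) * permAt J t := fun t h1 h2 =>
      permAt_of_fold m.2.le hf.mem hf.notMem ((hJ' k).2 (Or.inr rfl)) (fun i him hik => by
        rw [hJ', or_iff_left hik]
        refine and_iff_left ?_
        rintro rfl
        omega) h1 h2
    refine hf.crystalF_eq hJ hn hmax hlt hbe (fun t ht => permAt_congr fun i hi => ?_) hfold
      (fun t h1 h2 => permAt_of_unfold hmI hmJ ?_ (hfold _ hkm le_rfl) (fun i him => ?_) h1 h2)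
    · have h1 : i ≠ m := by
        rintro rfl
        have := hf.lt
        omega
      have h2 : i ≠ k := by
        rintro rfl
        omega
      rw [hJ', or_iff_left h2, and_iff_left h1]
    · rw [hJ']
      rintro (h | h)
      · exact h.2 rfl
      · exact hkm.ne' h
    · rw [hJ', or_iff_left (hkm.trans him).ne', and_iff_left him.ne']

/-- Where `content` is maximal, its double is at most `height + 1`, which is a value of the doubled
graph unless `height = 1` and `p = 0`. In that case the content is at most `1`, below the two signs
`+` that a dual Demazure `0`-arrow requires. -/
theorem Admissible.lt_graphMax_of_plusCount (hJ : Admissible J) (hn : 2 ≤ n)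
    (hmax : ∀ v, GraphValue J (crystalRoot p) v → v ≤ z)
    (h : (if p = 0 then 1 else 0) < plusCount p (sfill J)) :
    (if p = 0 then 2 else 0 : ℤ) < z := by
  obtain ⟨t, ht, h1⟩ := exists_content_eq_plusCount p (sfill J)
  have h2 := height_blockTime (J := J) (crystalRoot_ne hn p) ht
  have h3 := orient_cases (permAt J (blockTime lam t)) (crystalRoot p)
  rcases hJ.graphValue_height_add_one (p := p) (blockTime_le (lam := lam) t) with h4 | ⟨h4, h5⟩
  · have := hmax _ h4
    split_ifs at h ⊢ <;> omega
  · rw [if_pos h5] at h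
    omega

theorem Admissible.lt_plusCount (hJ : Admissible J) (hn : 2 ≤ n)
    (hz : 2 * graphMax J (crystalRoot p) = z) (hv : GraphValue J (crystalRoot p) z)
    (hmax : ∀ v, GraphValue J (crystalRoot p) v → v ≤ z) (hlt : (if p = 0 then 2 else 0) < z) :
    (if p = 0 then 1 else 0) < plusCount p (sfill J) := by
  have hα := crystalRoot_ne hn p
  obtain ⟨t, ht⟩ : ∃ t, 2 * content (crystalRoot p) (sfill J) t = z := by
    obtain ⟨x, hx⟩ := hJ.maxSet_nonempty hn hz hv hmax hlt
    induction x using WithTop.recTopCoe with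
    | top =>
      have h2 := height_blockTime (J := J) hα (le_refl (lam.1.rowLen 0))
      rw [blockTime_last le_rfl] at h2
      exact ⟨_, h2.symm.trans ((mem_maxSet_top hn hz).1 hx)⟩
    | coe i =>
      obtain ⟨h1, h2⟩ := (mem_maxSet_coe hn hz).1 hx
      exact ⟨_, (height_of_mem hα h1).symm.trans h2⟩
  have := content_le_plusCount p (sfill J) t
  split_ifs at hlt ⊢ <;> omega

end Main

end QAlcove

theorem theorem4p3 {n : ℕ} [NeZero n] (hn : 2 ≤ n) (lam : QAlcove.Shape n)
    (J : Finset (QAlcove.Pos lam)) (hJ : QAlcove.Admissible J) (p : Fin n) :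
    (QAlcove.DualDemazure p (QAlcove.sfill J) ↔ QAlcove.alcoveF p J ≠ none) ∧
    (∀ J' : Finset (QAlcove.Pos lam), QAlcove.alcoveF p J = some J' →
      QAlcove.crystalF p (QAlcove.sfill J) = some (QAlcove.sfill J')) := by
  obtain ⟨z, hz, hv, hmax⟩ := QAlcove.exists_graphMax J (QAlcove.crystalRoot_ne hn p)
  rw [QAlcove.dualDemazure_iff hn]
  -- Since `z` is twice the maximum, the threshold is `2 δ_{p,0}`.
  by_cases hlt : (if p = 0 then 2 else 0) < z
  · obtain ⟨J', h1, h2⟩ := hJ.alcoveF_eq_some hn hz hv hmax hlt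
    refine ⟨iff_of_true (hJ.lt_plusCount hn hz hv hmax hlt) (by simp [h1]), fun K hK => ?_⟩
    rw [h1, Option.some_inj] at hK
    rw [← hK, h2]
  · have hM : ¬ (if p = 0 then 1 else 0 : ℚ) < QAlcove.graphMax J (QAlcove.crystalRoot p) := by
      have h : (z : ℚ) ≤ ((if p = 0 then 2 else 0 : ℤ) : ℚ) := by exact_mod_cast not_lt.1 hlt
      rw [← hz] at h
      rw [not_lt]
      split_ifs at h ⊢ <;> push_cast at h <;> linarith
    have hnone : QAlcove.alcoveF p J = none := if_neg hM
    rw [hnone]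
    exact ⟨iff_of_false (fun h => hlt (hJ.lt_graphMax_of_plusCount hn hmax h)) (by simp),
      fun _ h => by cases h⟩
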